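/- Let $\mathbb K=\mathbb R$ or $\mathbb C$ and let $M$ be a finite-dimensional manifold, real $C^\infty$ if $\mathbb K=\mathbb R$ and complex if $\mathbb K=\mathbb C$ ("smooth" means $C^\infty$, respectively holomorphic). Let $(\Lambda,\Lambda_1)$ be a bihamiltonian structure on $M$, that is, $\Lambda$, $\Lambda_1$ and $\Lambda+\Lambda_1$ are smooth Poisson structures. The rank of a pair of bivectors $(\lambda,\lambda_1)$ on a finite-dimensional vector space is the maximum of the ranks of $(1-t)\lambda+t\lambda_1$, $t\in\mathbb K$; the pair is maximal if $\operatorname{rank}\lambda=\operatorname{rank}\lambda_1=\operatorname{rank}(\lambda,\lambda_1)$. A maximal pair is a product of Kronecker elementary pairs (on odd-dimensional spaces with a basis $e_0,\dots,e_{2k}$ in which the pair is $\sum_{i<k}e_{2i}\wedge e_{2i+1}$, $\sum_{i<k}e_{2i+1}\wedge e_{2i+2}$) and of a symplectic pair (both bivectors nondegenerate), called its symplectic factor; the factors are unique up to isomorphism and order. The characteristic polynomial of the symplectic factor is that of the endomorphism $K$ given by $\tau_1=\tau(K\,\cdot,\cdot)$, where $\tau,\tau_1$ are the symplectic forms corresponding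 to its two bivectors. Let $M'\subseteq M$ be an open set such that $(\Lambda(p),\Lambda_1(p))$ is maximal for every $p\in M'$, and such that on $M'$ the rank of $(\Lambda,\Lambda_1)$ is constant and the dimension of the symplectic factor is constant, equal to $2m'$. For $p\in M'$ let $$t^{2m'}+\sum_{j=0}^{2m'-1}\tilde h_j(p)\,t^j$$ be the characteristic polynomial of the symplectic factor of $(\Lambda(p),\Lambda_1(p))$. Then the functions $\tilde h_0,\dots,\tilde h_{2m'-1}$ are smooth on $M'$ and they are in involution for both structures: $\Lambda(d\tilde h_i,d\tilde h_j)=0$ and $\Lambda_1(d\tilde h_i,d\tilde h_j)=0$ on $M'$ for all $i,j$. Moreover, for every $p\in M'$ the families $\{\Lambda(d\tilde h_j,\cdot)(p)\}_{j=0,\dots,2m'-1}$ and $\{\Lambda_1(d\tilde h_j,\cdot)(p)\}_{j=0,\dots,2m'-1}$ span the same vector subspace of $T_pM$. -/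

import Mathlib

open scoped Manifold ContDiff
open Module

noncomputable section

/-! ## Linear algebra of bivectors

A bivector on a finite dimensional vector space `W` is represented as an alternating bilinear
form on the dual space `W*`. -/

namespace Bivector

variable {𝕜 : Type*} [Field 𝕜] {V : Type*} [AddCommGroup V] [Module 𝕜 V]
  {W : Type*} [AddCommGroup W] [Module 𝕜 W]

/-- The bivector `u ∧ v`, that is `(α, β) ↦ α u * β v - α v * β u`. -/
def wedge (u v : W) : LinearMap.BilinForm 𝕜 (Dual 𝕜 W) :=
  (LinearMap.mul 𝕜 𝕜).compl₁₂ (Dual.eval 𝕜 W u) (Dual.eval 𝕜 W v) -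
    (LinearMap.mul 𝕜 𝕜).compl₁₂ (Dual.eval 𝕜 W v) (Dual.eval 𝕜 W u)

/-- The push-forward of a bivector by a linear map `f`, `(α, β) ↦ μ (α ∘ f, β ∘ f)`. -/
def push (f : V →ₗ[𝕜] W) (μ : LinearMap.BilinForm 𝕜 (Dual 𝕜 V)) :
    LinearMap.BilinForm 𝕜 (Dual 𝕜 W) :=
  μ.compl₁₂ f.dualMap f.dualMap

/-- The rank of a bivector. -/
def rank (μ : LinearMap.BilinForm 𝕜 (Dual 𝕜 W)) : ℕ := finrank 𝕜 (LinearMap.range μ)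

/-- The rank of a pair of bivectors: the maximum of the ranks of `(1 - t) μ + t μ₁`, `t ∈ 𝕜`
(the set of these ranks is bounded by `dim W`). -/
def pairRank (μ μ₁ : LinearMap.BilinForm 𝕜 (Dual 𝕜 W)) : ℕ :=
  ⨆ t : 𝕜, rank ((1 - t) • μ + t • μ₁)

/-- A pair of bivectors is maximal when both of them have the rank of the pair. -/
def IsMaximal (μ μ₁ : LinearMap.BilinForm 𝕜 (Dual 𝕜 W)) : Prop :=
  rank μ = pairRank μ μ₁ ∧ rank μ₁ = pairRank μ μ₁

/-- A Kronecker elementary pair on a vector space of odd dimension `2 k + 1`: for some basis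
`e₀, …, e₂ₖ` one has `μ = ∑_{i < k} e_{2i} ∧ e_{2i+1}` and `μ₁ = ∑_{i < k} e_{2i+1} ∧ e_{2i+2}`.
These are exactly the pairs in the dense open orbit of the general linear group acting on pairs
of bivectors. -/
def IsKroneckerElementary (μ μ₁ : LinearMap.BilinForm 𝕜 (Dual 𝕜 V)) : Prop :=
  ∃ (k : ℕ) (e : Basis (Fin (2 * k + 1)) 𝕜 V),
    μ = ∑ i : Fin k, wedge (e ⟨2 * i, by omega⟩) (e ⟨2 * i + 1, by omega⟩) ∧
    μ₁ = ∑ i : Fin k, wedge (e ⟨2 * i + 1, by omega⟩) (e ⟨2 * i + 2, by omega⟩)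

variable [FiniteDimensional 𝕜 V] [FiniteDimensional 𝕜 W]

/-- The linear map `α ↦ μ (α, ·)` from `W*` to `W = W**`; so `β (sharp μ α) = μ α β`. -/
def sharp (μ : LinearMap.BilinForm 𝕜 (Dual 𝕜 W)) : Dual 𝕜 W →ₗ[𝕜] W :=
  (evalEquiv 𝕜 W).symm.toLinearMap ∘ₗ μ

/-- A nondegenerate bivector identifies `V*` with `V` through `α ↦ μ (α, ·)`. This is the inverse
isomorphism `V → V*`. -/
def flat (μ : LinearMap.BilinForm 𝕜 (Dual 𝕜 V)) (hμ : μ.Nondegenerate) : V ≃ₗ[𝕜] Dual 𝕜 V :=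
  (evalEquiv 𝕜 V).trans (μ.toDual hμ).symm

theorem flat_sharp (μ : LinearMap.BilinForm 𝕜 (Dual 𝕜 V)) (hμ : μ.Nondegenerate)
    (α : Dual 𝕜 V) : flat μ hμ (sharp μ α) = α := by
  simp only [flat, sharp, LinearEquiv.trans_apply, LinearMap.comp_apply, LinearEquiv.coe_coe,
    LinearEquiv.apply_symm_apply]
  exact (μ.toDual hμ).symm_apply_apply α

/-- The symplectic form on `V` that corresponds to a nondegenerate bivector: the bivector
transported to `V` by means of the identification of `V` with `V*`. -/
def toForm (μ : LinearMap.BilinForm 𝕜 (Dual 𝕜 V)) (hμ : μ.Nondegenerate) :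
    LinearMap.BilinForm 𝕜 V :=
  μ.compl₁₂ (flat μ hμ).toLinearMap (flat μ hμ).toLinearMap

theorem toForm_nondegenerate (μ : LinearMap.BilinForm 𝕜 (Dual 𝕜 V)) (hμ : μ.Nondegenerate) :
    (toForm μ hμ).Nondegenerate := by
  refine ⟨fun x hx => ?_, fun y hy => ?_⟩
  · have h := hμ.1 (flat μ hμ x) fun β => by
      simpa [toForm] using hx ((flat μ hμ).symm β)
    simpa using h
  · have h := hμ.2 (flat μ hμ y) fun β => by
      simpa [toForm] using hy ((flat μ hμ).symm β)
    simpa using h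

/-- The characteristic polynomial of a pair `(τ, τ₁)` of `2`-forms with `τ` symplectic: that of
the endomorphism `K` defined by `τ₁ (u, v) = τ (K u, v)`. -/
def formCharpoly (τ τ₁ : LinearMap.BilinForm 𝕜 V) (hτ : τ.Nondegenerate) : Polynomial 𝕜 :=
  (LinearMap.BilinForm.symmCompOfNondegenerate τ₁ τ hτ).charpoly

/-- A decomposition of a pair of bivectors on `W` as a product of Kronecker elementary pairs
`(U j, κ j, κ₁ j)` and a symplectic pair `(S, σ, σ₁)`. -/
structure Decomposition (μ μ₁ : LinearMap.BilinForm 𝕜 (Dual 𝕜 W)) where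
  /-- the number of Kronecker elementary factors -/
  r : ℕ
  /-- the spaces of the Kronecker elementary factors -/
  U : Fin r → Submodule 𝕜 W
  /-- the space of the symplectic factor -/
  S : Submodule 𝕜 W
  κ : ∀ j, LinearMap.BilinForm 𝕜 (Dual 𝕜 (U j))
  κ₁ : ∀ j, LinearMap.BilinForm 𝕜 (Dual 𝕜 (U j))
  σ : LinearMap.BilinForm 𝕜 (Dual 𝕜 S)
  σ₁ : LinearMap.BilinForm 𝕜 (Dual 𝕜 S)
  isInternal : DirectSum.IsInternal fun o : Option (Fin r) => o.elim S U
  kronecker : ∀ j, IsKroneckerElementary (κ j) (κ₁ j)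
  alt : σ.IsAlt
  alt₁ : σ₁.IsAlt
  nondegenerate : σ.Nondegenerate
  nondegenerate₁ : σ₁.Nondegenerate
  eq_sum : μ = push S.subtype σ + ∑ j, push (U j).subtype (κ j)
  eq_sum₁ : μ₁ = push S.subtype σ₁ + ∑ j, push (U j).subtype (κ₁ j)

open Classical in
/-- The dimension of the symplectic factor of a pair of bivectors. The factors of a decomposition
are unique up to isomorphism, so that the choice does not matter; a pair without a decomposition
(which cannot be maximal) gets the value `0`. -/
def symplecticDim (μ μ₁ : LinearMap.BilinForm 𝕜 (Dual 𝕜 W)) : ℕ :=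
  if h : Nonempty (Decomposition μ μ₁) then finrank 𝕜 h.some.S else 0

open Classical in
/-- The characteristic polynomial of the symplectic factor of a pair of bivectors, the latter
being regarded as a pair of symplectic forms. -/
def symplecticCharpoly (μ μ₁ : LinearMap.BilinForm 𝕜 (Dual 𝕜 W)) : Polynomial 𝕜 :=
  if h : Nonempty (Decomposition μ μ₁) then
    formCharpoly (toForm h.some.σ h.some.nondegenerate) (toForm h.some.σ₁ h.some.nondegenerate₁)
      (toForm_nondegenerate h.some.σ h.some.nondegenerate)
  else 1

end Bivector

/-! ## Poisson and bihamiltonian structures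

`M` is a manifold without boundary over `𝕜 = ℝ` (then `∞` means smooth) or over `𝕜 = ℂ` (then
differentiability over `ℂ` makes everything holomorphic). -/

namespace Bihamiltonian

variable {𝕜 : Type*} [RCLike 𝕜] {E : Type*} [NormedAddCommGroup E] [NormedSpace 𝕜 E]
  {M : Type*} [TopologicalSpace M] [ChartedSpace E M]

/-- Assignments of a bilinear form on the cotangent space to each point of `M`. -/
abbrev BivectorField (𝕜 : Type*) [RCLike 𝕜] (E : Type*) [NormedAddCommGroup E] [NormedSpace 𝕜 E]
    (M : Type*) [TopologicalSpace M] [ChartedSpace E M] : Type _ :=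
  ∀ p : M, LinearMap.BilinForm 𝕜 (Dual 𝕜 (TangentSpace 𝓘(𝕜, E) p))

variable (E) in
/-- The differential of a function at a point, as an element of the cotangent space. -/
def differential (f : M → 𝕜) (p : M) : Dual 𝕜 (TangentSpace 𝓘(𝕜, E) p) :=
  (mfderiv 𝓘(𝕜, E) 𝓘(𝕜, 𝕜) f p : TangentSpace 𝓘(𝕜, E) p →L[𝕜] 𝕜).toLinearMap

/-- The bracket `{f, g} = Λ(df, dg)`. -/
def bracket (Λ : BivectorField 𝕜 E M) (f g : M → 𝕜) (p : M) : 𝕜 :=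
  Λ p (differential E f p) (differential E g p)

/-- `Λ` is a Poisson structure: a field of bivectors, which is smooth (holomorphic), that is the
bracket of two smooth local functions is smooth, and whose bracket satisfies the Jacobi identity
on smooth local functions. Local functions are needed since a complex manifold may have few
global ones. -/
structure IsPoisson (Λ : BivectorField 𝕜 E M) : Prop where
  alt : ∀ p, (Λ p).IsAlt
  smooth : ∀ (U : Set M), IsOpen U → ∀ f g : M → 𝕜,
    ContMDiffOn 𝓘(𝕜, E) 𝓘(𝕜, 𝕜) ∞ f U → ContMDiffOn 𝓘(𝕜, E) 𝓘(𝕜, 𝕜) ∞ g U →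
    ContMDiffOn 𝓘(𝕜, E) 𝓘(𝕜, 𝕜) ∞ (bracket Λ f g) U
  jacobi : ∀ (U : Set M), IsOpen U → ∀ f g h : M → 𝕜,
    ContMDiffOn 𝓘(𝕜, E) 𝓘(𝕜, 𝕜) ∞ f U → ContMDiffOn 𝓘(𝕜, E) 𝓘(𝕜, 𝕜) ∞ g U →
    ContMDiffOn 𝓘(𝕜, E) 𝓘(𝕜, 𝕜) ∞ h U → ∀ p ∈ U,
    bracket Λ f (bracket Λ g h) p + bracket Λ g (bracket Λ h f) p +
      bracket Λ h (bracket Λ f g) p = 0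

/-- `(Λ, Λ₁)` is a bihamiltonian structure. -/
structure IsBihamiltonian (Λ Λ₁ : BivectorField 𝕜 E M) : Prop where
  poisson : IsPoisson Λ
  poisson₁ : IsPoisson Λ₁
  compatible : IsPoisson fun p => Λ p + Λ₁ p

variable [FiniteDimensional 𝕜 E]

instance (p : M) : FiniteDimensional 𝕜 (TangentSpace 𝓘(𝕜, E) p) :=
  inferInstanceAs (FiniteDimensional 𝕜 E)

/-- The vector `Λ(df, ·)(p)`, the value at `p` of the hamiltonian of `f`. -/
def hamiltonian (Λ : BivectorField 𝕜 E M) (f : M → 𝕜) (p : M) : TangentSpace 𝓘(𝕜, E) p :=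
  Bivector.sharp (Λ p) (differential E f p)

/-- The function on `M` whose value at `p` is the coefficient of degree `j` of the characteristic
polynomial of the symplectic factor of `(Λ(p), Λ₁(p))`. -/
def charCoeff (Λ Λ₁ : BivectorField 𝕜 E M) (j : ℕ) (p : M) : 𝕜 :=
  (Bivector.symplecticCharpoly (Λ p) (Λ₁ p)).coeff j

end Bihamiltonian

end

/-! Choose coordinates (x, y, z) on the cotangent space at a point: x and y are the values of a
covector on the even and odd basis vectors of the Kronecker factors, z its values on a basis of the
symplectic factor. Then the pair is a sum of shift blocks pairing x with y and of nondegenerate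
matrices (G, G₁) acting on z, and the characteristic polynomial is p(t) = det(t G₁ - G) / det G₁. On
covectors with y = 0 both bivectors see only z.

Such covectors must be extended smoothly, although the sizes of the Kronecker blocks may jump from
point to point. Consider chains c₀, …, c_N with μ(c_i, ·) = μ₁(c_{i+1}, ·). If N is at least the sum
of the block sizes, every c_i has y = 0, every z occurs in some c₀, and the dimension of the space
of chains depends only on N, d, the number r of blocks and the sum of their sizes
(`BlockForm.finrank_ker_chainMap`). These are locally constant, so the chains form a smooth bundle,
and their zeroth terms give smooth 1-forms η₁, …, η_d that restrict to a basis of the symplectic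
part at the chosen point (`exists_frame`).

For this family put D_t = det((tΛ₁ - Λ)(η_i, η_j)) and δ = det(Λ₁(η_i, η_j)). Then p(t) δ = D_t,
which gives smoothness. The Jacobi identity of A = tΛ₁ - Λ yields A(γ, dD_t) = -2 D_t (t q₁ - q),
with q and q₁ independent of t (`apply_fderiv_det_gram`). Dividing out δ and writing θ(t) = ∑ tʲ
dh_j for the differential of p(t), one finds (tΛ₁ - Λ)(γ, θ(t)) = p(t)(a + b t), with a and b
depending on γ only.

The rest is algebra (`involution_and_span_eq`). Degrees in t force b = 0, and then a = Λ₁(γ,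
dh_{d-1}). Taking γ = θ(t) kills the left side, so Λ₁(dh_j, dh_{d-1}) = 0 for all j, and the
coefficients of the identity become a Lenard recursion. Involution follows from it by skew-symmetry.
The equality of spans also uses p(0) ≠ 0. -/

noncomputable section

namespace Bivector

/-! ### Block form of a pair of bivectors -/

section BlockForm

variable {𝕜 : Type*} [Field 𝕜]

/-- The restriction of a family on `∑ j, {0, …, k j}` to the first `k j` indices of each block. -/
def dropLast {r : ℕ} (k : Fin r → ℕ) :
    ((Σ j, Fin (k j + 1)) → 𝕜) →ₗ[𝕜] ((Σ j, Fin (k j)) → 𝕜) :=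
  LinearMap.funLeft 𝕜 𝕜 fun a => ⟨a.1, a.2.castSucc⟩

/-- The negative of the restriction of a family on `∑ j, {0, …, k j}` to the last `k j` indices
of each block. -/
def negTail {r : ℕ} (k : Fin r → ℕ) :
    ((Σ j, Fin (k j + 1)) → 𝕜) →ₗ[𝕜] ((Σ j, Fin (k j)) → 𝕜) :=
  -LinearMap.funLeft 𝕜 𝕜 fun a => ⟨a.1, a.2.succ⟩

@[simp] theorem dropLast_apply {r : ℕ} (k : Fin r → ℕ) (x : (Σ j, Fin (k j + 1)) → 𝕜)
    (a : Σ j, Fin (k j)) : dropLast k x a = x ⟨a.1, a.2.castSucc⟩ := rfl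

@[simp] theorem negTail_apply {r : ℕ} (k : Fin r → ℕ) (x : (Σ j, Fin (k j + 1)) → 𝕜)
    (a : Σ j, Fin (k j)) : negTail k x a = -x ⟨a.1, a.2.succ⟩ := rfl

theorem dropLast_surjective {r : ℕ} (k : Fin r → ℕ) :
    Function.Surjective (dropLast (𝕜 := 𝕜) k) := fun y =>
  ⟨fun a => Fin.lastCases (motive := fun _ => 𝕜) 0 (fun i => y ⟨a.1, i⟩) a.2, by
    ext a; simp⟩

theorem negTail_surjective {r : ℕ} (k : Fin r → ℕ) :
    Function.Surjective (negTail (𝕜 := 𝕜) k) := fun y =>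
  ⟨fun a => Fin.cases (motive := fun _ => 𝕜) 0 (fun i => -y ⟨a.1, i⟩) a.2, by
    ext a; simp⟩

variable {V : Type*} [AddCommGroup V] [Module 𝕜 V]

/-- A linear isomorphism of `V` with `𝕜^x × 𝕜^y × 𝕜^d` in which a pair of bilinear forms is the
orthogonal sum of Kronecker blocks and of the pair of nondegenerate matrices `(G, G₁)`. -/
structure BlockForm (μ μ₁ : LinearMap.BilinForm 𝕜 V) (d : ℕ) where
  r : ℕ
  k : Fin r → ℕ
  e : V ≃ₗ[𝕜] ((Σ j, Fin (k j + 1)) → 𝕜) × ((Σ j, Fin (k j)) → 𝕜) × (Fin d → 𝕜)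
  G : Matrix (Fin d) (Fin d) 𝕜
  G₁ : Matrix (Fin d) (Fin d) 𝕜
  det_ne_zero : G.det ≠ 0
  det_ne_zero₁ : G₁.det ≠ 0
  apply_eq : ∀ a b, μ a b = dropLast k (e a).1 ⬝ᵥ (e b).2.1 - dropLast k (e b).1 ⬝ᵥ (e a).2.1 +
    Matrix.vecMul (e a).2.2 G ⬝ᵥ (e b).2.2
  apply_eq₁ : ∀ a b, μ₁ a b = negTail k (e a).1 ⬝ᵥ (e b).2.1 - negTail k (e b).1 ⬝ᵥ (e a).2.1 +
    Matrix.vecMul (e a).2.2 G₁ ⬝ᵥ (e b).2.2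

namespace BlockForm

variable {μ μ₁ : LinearMap.BilinForm 𝕜 V} {d : ℕ}

/-- Transport of a block form along a linear isomorphism. -/
def congr (F : BlockForm μ μ₁ d) {V' : Type*} [AddCommGroup V'] [Module 𝕜 V'] (f : V' ≃ₗ[𝕜] V)
    {ν ν₁ : LinearMap.BilinForm 𝕜 V'} (h : ∀ a b, ν a b = μ (f a) (f b))
    (h₁ : ∀ a b, ν₁ a b = μ₁ (f a) (f b)) : BlockForm ν ν₁ d where
  r := F.r
  k := F.k
  e := f.trans F.e
  G := F.G
  G₁ := F.G₁
  det_ne_zero := F.det_ne_zero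
  det_ne_zero₁ := F.det_ne_zero₁
  apply_eq a b := by simp [h, F.apply_eq]
  apply_eq₁ a b := by simp [h₁, F.apply_eq₁]

/-- The sum of the sizes of the blocks. -/
def size (F : BlockForm μ μ₁ d) : ℕ := ∑ j, F.k j

theorem finrank_eq (F : BlockForm μ μ₁ d) : finrank 𝕜 V = 2 * F.size + F.r + d := by
  rw [F.e.finrank_eq]
  simp [size, Finset.sum_add_distrib]
  ring

theorem apply_eq_zero_iff (F : BlockForm μ μ₁ d) (a : V) :
    μ a = 0 ↔ dropLast F.k (F.e a).1 = 0 ∧ (F.e a).2.1 = 0 ∧ (F.e a).2.2 = 0 := by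
  constructor
  · intro h
    have h' : ∀ b, μ a b = 0 := fun b => by simp [h]
    simp only [F.apply_eq] at h'
    refine ⟨?_, ?_, ?_⟩
    · refine dotProduct_eq_zero _ fun y => ?_
      simpa using h' (F.e.symm (0, y, 0))
    · refine dotProduct_eq_zero _ fun y => ?_
      obtain ⟨x, rfl⟩ := dropLast_surjective F.k y
      simpa [dotProduct_comm] using h' (F.e.symm (x, 0, 0))
    · refine Matrix.eq_zero_of_vecMul_eq_zero F.det_ne_zero (dotProduct_eq_zero _ fun y => ?_)
      simpa using h' (F.e.symm (0, 0, y))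
  · rintro ⟨h1, h2, h3⟩
    ext b
    simp [F.apply_eq, h1, h2, h3]

theorem finrank_ker_dropLast {r : ℕ} (k : Fin r → ℕ) :
    finrank 𝕜 (LinearMap.ker (dropLast (𝕜 := 𝕜) k)) = r := by
  have h := LinearMap.finrank_range_add_finrank_ker (dropLast (𝕜 := 𝕜) k)
  rw [LinearMap.range_eq_top.2 (dropLast_surjective k)] at h
  simp [Finset.sum_add_distrib] at h
  exact h

variable [FiniteDimensional 𝕜 V]

/-- The kernel lies in the x coordinates and each Kronecker block contributes one dimension to it.
Hence the corank counts the blocks, whatever their sizes. -/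
theorem finrank_range_add (F : BlockForm μ μ₁ d) :
    finrank 𝕜 (LinearMap.range μ) + F.r = finrank 𝕜 V := by
  rw [← LinearMap.finrank_range_add_finrank_ker μ]
  congr 1
  let f : LinearMap.ker (dropLast (𝕜 := 𝕜) F.k) →ₗ[𝕜] V :=
    F.e.symm.toLinearMap ∘ₗ LinearMap.inl 𝕜 _ _ ∘ₗ Submodule.subtype _
  have hf : Function.Injective f :=
    F.e.symm.injective.comp (LinearMap.inl_injective.comp Subtype.val_injective)
  have hr : LinearMap.range f = LinearMap.ker μ := by
    ext a
    rw [LinearMap.mem_ker, F.apply_eq_zero_iff]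
    constructor
    · rintro ⟨x, rfl⟩
      have := x.2
      rw [LinearMap.mem_ker] at this
      simp [f, this]
    · rintro ⟨h1, h2, h3⟩
      refine ⟨⟨(F.e a).1, h1⟩, ?_⟩
      simp only [f, LinearMap.comp_apply, LinearEquiv.coe_coe, Submodule.subtype_apply,
        LinearMap.inl_apply]
      rw [LinearEquiv.symm_apply_eq]
      ext1
      · rfl
      · ext1 <;> simp [h2, h3]
  rw [← hr, LinearMap.finrank_range_of_inj hf, finrank_ker_dropLast]

end BlockForm

end BlockForm

end Bivector

namespace Bivector

/-! ### Chains of a pair of bilinear forms -/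

section Chain

variable {𝕜 : Type*} [Field 𝕜]

theorem single_comp_of_injective {α β : Type*} [DecidableEq α] [DecidableEq β] {f : α → β}
    (hf : Function.Injective f) (a : α) :
    (Pi.single (f a) (1 : 𝕜) : β → 𝕜) ∘ f = Pi.single a 1 := by
  ext b
  simp [Pi.single_apply, hf.eq_iff]

theorem single_comp_of_notMem_range {α β : Type*} [DecidableEq β] {f : α → β} {b : β}
    (hb : ∀ a, f a ≠ b) : (Pi.single b (1 : 𝕜) : β → 𝕜) ∘ f = 0 := by
  ext a
  simp [hb a]

section Shift

variable {r : ℕ} (k : Fin r → ℕ)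

theorem dropLast_single_castSucc (j : Fin r) (i : Fin (k j)) :
    dropLast (𝕜 := 𝕜) k (Pi.single ⟨j, i.castSucc⟩ 1) = Pi.single ⟨j, i⟩ 1 :=
  single_comp_of_injective (f := fun a : Σ j, Fin (k j) =>
    (⟨a.1, a.2.castSucc⟩ : Σ j, Fin (k j + 1)))
    (by
      rintro ⟨j, i⟩ ⟨j', i'⟩ h
      obtain rfl : j = j' := congrArg Sigma.fst h
      simpa using h) ⟨j, i⟩

theorem dropLast_single_last (j : Fin r) :
    dropLast (𝕜 := 𝕜) k (Pi.single ⟨j, Fin.last _⟩ 1) = 0 :=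
  single_comp_of_notMem_range (by
    rintro ⟨j', i⟩ h
    obtain rfl : j' = j := congrArg Sigma.fst h
    simp at h)

theorem negTail_single_succ (j : Fin r) (i : Fin (k j)) :
    negTail (𝕜 := 𝕜) k (Pi.single ⟨j, i.succ⟩ 1) = -Pi.single ⟨j, i⟩ 1 :=
  congrArg Neg.neg <| single_comp_of_injective (f := fun a : Σ j, Fin (k j) =>
    (⟨a.1, a.2.succ⟩ : Σ j, Fin (k j + 1)))
    (by
      rintro ⟨j, i⟩ ⟨j', i'⟩ h
      obtain rfl : j = j' := congrArg Sigma.fst h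
      simpa using h) ⟨j, i⟩

theorem negTail_single_zero (j : Fin r) :
    negTail (𝕜 := 𝕜) k (Pi.single ⟨j, 0⟩ 1) = 0 := by
  exact neg_eq_zero.2 <| single_comp_of_notMem_range (𝕜 := 𝕜) (f := fun a : Σ j, Fin (k j) =>
    (⟨a.1, a.2.succ⟩ : Σ j, Fin (k j + 1))) (b := ⟨j, 0⟩) (by
    rintro ⟨j', i⟩ h
    obtain rfl : j' = j := congrArg Sigma.fst h
    simp at h)

/-- The transposed shifts admit no long chains. -/
theorem eq_zero_of_dual_chain {N : ℕ} (hN : ∀ j, k j ≤ N) (y : ℕ → (Σ j, Fin (k j)) → 𝕜)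
    (hy : ∀ i < N, ∀ x, dropLast k x ⬝ᵥ y i = negTail k x ⬝ᵥ y (i + 1)) :
    ∀ i ≤ N, y i = 0 := by
  -- Test vectors x turn the hypothesis into scalar relations: up to sign the entries of y are
  -- constant along the antidiagonals of (i, l), and they vanish at the entry l = 0 for i < N and at
  -- the last entry for i > 0.
  have h0 : ∀ i < N, ∀ j (h : 0 < k j), y i ⟨j, ⟨0, h⟩⟩ = 0 := fun i hi j h => by
    have h1 := hy i hi (Pi.single ⟨j, (⟨0, h⟩ : Fin (k j)).castSucc⟩ 1)
    rw [dropLast_single_castSucc] at h1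
    have h2 : (⟨0, h⟩ : Fin (k j)).castSucc = 0 := rfl
    rw [h2, negTail_single_zero] at h1
    simpa using h1
  have h1 : ∀ i < N, ∀ j l (h : l + 1 < k j),
      y i ⟨j, ⟨l + 1, h⟩⟩ = -y (i + 1) ⟨j, ⟨l, by omega⟩⟩ := fun i hi j l h => by
    have h1 := hy i hi (Pi.single ⟨j, (⟨l + 1, h⟩ : Fin (k j)).castSucc⟩ 1)
    rw [dropLast_single_castSucc] at h1
    have h2 : (⟨l + 1, h⟩ : Fin (k j)).castSucc = (⟨l, by omega⟩ : Fin (k j)).succ := rfl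
    rw [h2, negTail_single_succ] at h1
    simpa using h1
  have h2 : ∀ i < N, ∀ j l (h : l + 1 = k j), y (i + 1) ⟨j, ⟨l, by omega⟩⟩ = 0 :=
    fun i hi j l h => by
    have h1 := hy i hi (Pi.single ⟨j, (⟨l, by omega⟩ : Fin (k j)).succ⟩ 1)
    rw [negTail_single_succ] at h1
    have h2 : (⟨l, by omega⟩ : Fin (k j)).succ = Fin.last _ := Fin.ext h
    rw [h2, dropLast_single_last] at h1
    simpa using h1
  -- An antidiagonal with i + l < N is followed down to l = 0.
  have h3 : ∀ l i j (h : l < k j), i + l < N → y i ⟨j, ⟨l, h⟩⟩ = 0 := by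
    intro l
    induction l with
    | zero => exact fun i j h hi => h0 i hi j h
    | succ l ih =>
      intro i j h hi
      rw [h1 i (by omega) j l h, ih (i + 1) j _ (by omega), neg_zero]
  -- Otherwise it is followed up to the last entry l = k j - 1; since k j ≤ N ≤ i + l, the index i
  -- is still positive there.
  have h4 : ∀ s l i j (h : l < k j), l + 1 + s = k j → i ≤ N → N ≤ i + l →
      y i ⟨j, ⟨l, h⟩⟩ = 0 := by
    intro s
    induction s with
    | zero =>
      intro l i j h hs hi hil
      have := hN j
      obtain ⟨i, rfl⟩ : ∃ i', i = i' + 1 := ⟨i - 1, by omega⟩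
      exact h2 i (by omega) j l (by omega)
    | succ s ih =>
      intro l i j h hs hi hil
      have := hN j
      obtain ⟨i, rfl⟩ : ∃ i', i = i' + 1 := ⟨i - 1, by omega⟩
      have h5 := h1 i (by omega) j l (by omega)
      rw [ih (l + 1) i j (by omega) (by omega) (by omega) (by omega)] at h5
      exact neg_eq_zero.1 h5.symm
  intro i hi
  ext ⟨j, ⟨l, h⟩⟩
  rcases lt_or_ge (i + l) N with h5 | h5
  · exact h3 l i j h h5
  · exact h4 (k j - l - 1) l i j h (by omega) hi h5

/-- The linear map whose kernel consists of the chains of the pair of shifts. -/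
def shiftChainMap (N : ℕ) : (Fin (N + 1) → (Σ j, Fin (k j + 1)) → 𝕜) →ₗ[𝕜]
    (Fin N → (Σ j, Fin (k j)) → 𝕜) :=
  LinearMap.pi fun i => dropLast k ∘ₗ LinearMap.proj i.castSucc -
    negTail k ∘ₗ LinearMap.proj i.succ

/-- Each term is solved from the previous one by a right inverse of `negTail`. -/
theorem shiftChainMap_surjective (N : ℕ) :
    Function.Surjective (shiftChainMap (𝕜 := 𝕜) k N) := by
  intro w
  obtain ⟨C, hC⟩ := (negTail_surjective (𝕜 := 𝕜) k).hasRightInverse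
  let w' : ℕ → (Σ j, Fin (k j)) → 𝕜 := fun i => if h : i < N then w ⟨i, h⟩ else 0
  let x : ℕ → (Σ j, Fin (k j + 1)) → 𝕜 := fun i =>
    Nat.rec 0 (fun i xi => C (dropLast k xi - w' i)) i
  refine ⟨fun i => x i, ?_⟩
  ext1 i
  have hx : x (i + 1) = C (dropLast k (x i) - w' i) := rfl
  simp only [shiftChainMap, LinearMap.pi_apply, LinearMap.sub_apply, LinearMap.comp_apply,
    LinearMap.proj_apply, Fin.val_castSucc, Fin.val_succ, hx]
  rw [hC]
  simp [w']

theorem finrank_ker_shiftChainMap (N : ℕ) :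
    finrank 𝕜 (LinearMap.ker (shiftChainMap (𝕜 := 𝕜) k N)) + N * ∑ j, k j =
      (N + 1) * (∑ j, k j + r) := by
  have h := LinearMap.finrank_range_add_finrank_ker (shiftChainMap (𝕜 := 𝕜) k N)
  rw [LinearMap.range_eq_top.2 (shiftChainMap_surjective k N)] at h
  simp [Finset.sum_add_distrib, finrank_pi_fintype] at h
  linarith

end Shift

variable {V : Type*} [AddCommGroup V] [Module 𝕜 V]

/-- The linear map whose kernel consists of the families `c` such that
`μ (c i, ·) = μ₁ (c (i + 1), ·)`. -/
def chainMap (μ μ₁ : LinearMap.BilinForm 𝕜 V) (N : ℕ) :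
    (Fin (N + 1) → V) →ₗ[𝕜] (Fin N → Dual 𝕜 V) :=
  LinearMap.pi fun i => μ ∘ₗ LinearMap.proj i.castSucc - μ₁ ∘ₗ LinearMap.proj i.succ

theorem mem_ker_chainMap {μ μ₁ : LinearMap.BilinForm 𝕜 V} {N : ℕ} {c : Fin (N + 1) → V} :
    c ∈ LinearMap.ker (chainMap μ μ₁ N) ↔ ∀ (i : Fin N) b, μ (c i.castSucc) b = μ₁ (c i.succ) b := by
  simp only [LinearMap.mem_ker, funext_iff, chainMap, LinearMap.pi_apply, LinearMap.sub_apply,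
    LinearMap.comp_apply, LinearMap.proj_apply, Pi.zero_apply, sub_eq_zero, LinearMap.ext_iff]

namespace BlockForm

variable {μ μ₁ : LinearMap.BilinForm 𝕜 V} {d : ℕ}

theorem mem_ker_chainMap_iff (F : BlockForm μ μ₁ d) {N : ℕ} {c : Fin (N + 1) → V} :
    c ∈ LinearMap.ker (chainMap μ μ₁ N) ↔ ∀ i : Fin N,
      dropLast F.k (F.e (c i.castSucc)).1 = negTail F.k (F.e (c i.succ)).1 ∧
      (∀ x, dropLast F.k x ⬝ᵥ (F.e (c i.castSucc)).2.1 =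
        negTail F.k x ⬝ᵥ (F.e (c i.succ)).2.1) ∧
      Matrix.vecMul (F.e (c i.castSucc)).2.2 F.G = Matrix.vecMul (F.e (c i.succ)).2.2 F.G₁ := by
  rw [mem_ker_chainMap]
  refine forall_congr' fun i => ?_
  simp only [F.apply_eq, F.apply_eq₁]
  constructor
  · intro h
    refine ⟨?_, ?_, ?_⟩
    · refine dotProduct_eq _ _ fun y => ?_
      simpa using h (F.e.symm (0, y, 0))
    · intro x
      simpa using h (F.e.symm (x, 0, 0))
    · refine dotProduct_eq _ _ fun y => ?_
      simpa using h (F.e.symm (0, 0, y))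
  · rintro ⟨h1, h2, h3⟩ b
    rw [h1, h2, h3]

/-- The zeroth term of a long chain has no component in the odd part of the Kronecker blocks. -/
theorem chain_zero_snd (F : BlockForm μ μ₁ d) {N : ℕ} (hN : F.size ≤ N) {c : Fin (N + 1) → V}
    (hc : c ∈ LinearMap.ker (chainMap μ μ₁ N)) (i : Fin (N + 1)) : (F.e (c i)).2.1 = 0 := by
  rw [F.mem_ker_chainMap_iff] at hc
  have h := eq_zero_of_dual_chain F.k (N := N)
    (fun j => (Finset.single_le_sum (fun _ _ => Nat.zero_le _) (Finset.mem_univ j)).trans hN)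
    (fun i => if h : i < N + 1 then (F.e (c ⟨i, h⟩)).2.1 else 0)
    (fun i hi x => by
      have := (hc ⟨i, hi⟩).2.1 x
      rw [dif_pos (by omega), dif_pos (by omega)]
      exact this) i (by omega)
  simpa [Nat.lt_succ_iff.1 i.2] using h

/-- The chain which starts from a vector of the symplectic part and a chain of shifts. -/
def chainOf (F : BlockForm μ μ₁ d) (N : ℕ) :
    LinearMap.ker (shiftChainMap (𝕜 := 𝕜) F.k N) × (Fin d → 𝕜) →ₗ[𝕜] (Fin (N + 1) → V) :=
  LinearMap.pi fun i => F.e.symm.toLinearMap ∘ₗ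
    LinearMap.prod (LinearMap.proj i ∘ₗ Submodule.subtype _ ∘ₗ LinearMap.fst 𝕜 _ _)
      (LinearMap.prod 0 (Matrix.vecMulLinear ((F.G * F.G₁⁻¹) ^ (i : ℕ)) ∘ₗ LinearMap.snd 𝕜 _ _))

theorem e_chainOf (F : BlockForm μ μ₁ d) (N : ℕ)
    (u : LinearMap.ker (shiftChainMap (𝕜 := 𝕜) F.k N) × (Fin d → 𝕜)) (i : Fin (N + 1)) :
    F.e (F.chainOf N u i) =
      (u.1.1 i, 0, Matrix.vecMul u.2 ((F.G * F.G₁⁻¹) ^ (i : ℕ))) := by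
  simp [chainOf]

theorem chainOf_injective (F : BlockForm μ μ₁ d) (N : ℕ) :
    Function.Injective (F.chainOf N) := by
  rw [← LinearMap.ker_eq_bot, LinearMap.ker_eq_bot']
  intro u hu
  have h := fun i => (F.e_chainOf N u i).symm
  simp only [hu, Pi.zero_apply, map_zero, Prod.mk_eq_zero] at h
  ext1
  · ext1
    funext i
    exact (h i).1
  · simpa using (h 0).2.2

/-- In a long chain y vanishes, the x components form an arbitrary chain of shifts, and the z
component is determined by its initial value, since G₁ is invertible. -/
theorem range_chainOf (F : BlockForm μ μ₁ d) {N : ℕ} (hN : F.size ≤ N) :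
    LinearMap.range (F.chainOf N) = LinearMap.ker (chainMap μ μ₁ N) := by
  have hdet : IsUnit F.G₁.det := isUnit_iff_ne_zero.2 F.det_ne_zero₁
  ext c
  constructor
  · rintro ⟨u, rfl⟩
    rw [F.mem_ker_chainMap_iff]
    intro i
    simp only [e_chainOf]
    refine ⟨?_, by simp, ?_⟩
    · have := congrFun (LinearMap.mem_ker.1 u.1.2) i
      exact sub_eq_zero.1 this
    · rw [Matrix.vecMul_vecMul, Matrix.vecMul_vecMul, Fin.val_succ, pow_succ, Fin.val_castSucc,
        Matrix.mul_assoc, Matrix.mul_assoc, Matrix.nonsing_inv_mul _ hdet, Matrix.mul_one]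
  · intro hc
    have hy := F.chain_zero_snd hN hc
    rw [F.mem_ker_chainMap_iff] at hc
    have hx : (fun i => (F.e (c i)).1) ∈ LinearMap.ker (shiftChainMap (𝕜 := 𝕜) F.k N) := by
      rw [LinearMap.mem_ker]
      funext i
      exact sub_eq_zero.2 (hc i).1
    have hz : ∀ i : Fin (N + 1),
        (F.e (c i)).2.2 = Matrix.vecMul (F.e (c 0)).2.2 ((F.G * F.G₁⁻¹) ^ (i : ℕ)) := by
      intro i
      induction i using Fin.induction with
      | zero => simp
      | succ i ih =>
        rw [Fin.val_succ, pow_succ, ← Matrix.vecMul_vecMul, ← Fin.val_castSucc, ← ih,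
          ← Matrix.vecMul_vecMul, (hc i).2.2, Matrix.vecMul_vecMul, Matrix.mul_nonsing_inv _ hdet,
          Matrix.vecMul_one]
    refine ⟨(⟨_, hx⟩, (F.e (c 0)).2.2), ?_⟩
    funext i
    apply F.e.injective
    rw [e_chainOf]
    ext1
    · rfl
    · ext1
      · exact (hy i).symm
      · exact (hz i).symm

/-- The block sizes enter only through their sum, so the dimension is insensitive to a change of
Kronecker type. -/
theorem finrank_ker_chainMap (F : BlockForm μ μ₁ d) {N : ℕ} (hN : F.size ≤ N) :
    finrank 𝕜 (LinearMap.ker (chainMap μ μ₁ N)) + N * F.size = (N + 1) * (F.size + F.r) + d := by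
  rw [← F.range_chainOf hN, LinearMap.finrank_range_of_inj (F.chainOf_injective N),
    finrank_prod, finrank_fin_fun]
  have := finrank_ker_shiftChainMap (𝕜 := 𝕜) F.k N
  simp only [size]
  linarith

/-- Every covector of the symplectic part begins a chain. -/
theorem exists_chain (F : BlockForm μ μ₁ d) {N : ℕ} (hN : F.size ≤ N) (z : Fin d → 𝕜) :
    ∃ c ∈ LinearMap.ker (chainMap μ μ₁ N), F.e (c 0) = (0, 0, z) := by
  rw [← F.range_chainOf hN]
  exact ⟨_, ⟨(0, z), rfl⟩, by simp [e_chainOf]⟩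

end BlockForm

end Chain

end Bivector

namespace Bivector

/-! ### The block form defined by a decomposition -/

section Decomposition

variable {𝕜 : Type*} [Field 𝕜]

section Charpoly

variable {V : Type*} [AddCommGroup V] [Module 𝕜 V] [FiniteDimensional 𝕜 V]

theorem apply_sharp (σ : LinearMap.BilinForm 𝕜 (Dual 𝕜 V)) (α β : Dual 𝕜 V) :
    β (sharp σ α) = σ α β := by
  simp [sharp]

theorem sharp_flat (σ : LinearMap.BilinForm 𝕜 (Dual 𝕜 V)) (hσ : σ.Nondegenerate) (u : V) :
    sharp σ (flat σ hσ u) = u := by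
  apply (flat σ hσ).injective
  rw [flat_sharp]

theorem toForm_apply (σ : LinearMap.BilinForm 𝕜 (Dual 𝕜 V)) (hσ : σ.Nondegenerate) (u v : V) :
    toForm σ hσ u v = flat σ hσ v u := by
  conv_rhs => rw [← sharp_flat σ hσ u, apply_sharp]
  rfl

/-- The endomorphism `K` with `τ₁ (u, v) = τ (K u, v)` in terms of bivectors. -/
theorem symmCompOfNondegenerate_toForm {σ σ₁ : LinearMap.BilinForm 𝕜 (Dual 𝕜 V)}
    (alt : σ.IsAlt) (alt₁ : σ₁.IsAlt) (hσ : σ.Nondegenerate) (hσ₁ : σ₁.Nondegenerate)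
    (α : Dual 𝕜 V) :
    LinearMap.BilinForm.symmCompOfNondegenerate (toForm σ₁ hσ₁) (toForm σ hσ)
      (toForm_nondegenerate σ hσ) (sharp σ₁ α) = sharp σ α := by
  have key : ∀ {ρ : LinearMap.BilinForm 𝕜 (Dual 𝕜 V)} (_ : ρ.IsAlt) (hρ : ρ.Nondegenerate) v,
      toForm ρ hρ (sharp ρ α) v = -α v := by
    intro ρ alt hρ v
    rw [toForm_apply, apply_sharp, ← LinearMap.IsAlt.neg alt (flat ρ hρ v) α, ← apply_sharp, sharp_flat]
  refine sub_eq_zero.1 ((toForm_nondegenerate σ hσ).1 _ fun v => ?_)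
  rw [map_sub, LinearMap.sub_apply, LinearMap.BilinForm.symmCompOfNondegenerate_left_apply,
    key alt₁, key alt, sub_self]

/-- The relation K ∘ σ₁♯ = σ♯ reads G₁ Kᵀ = G in matrices, so that G₁ (t - Kᵀ) = t G₁ - G. -/
theorem eval_formCharpoly_mul_det {ι : Type*} [Fintype ι] [DecidableEq ι] (b : Basis ι 𝕜 V)
    {σ σ₁ : LinearMap.BilinForm 𝕜 (Dual 𝕜 V)}
    (alt : σ.IsAlt) (alt₁ : σ₁.IsAlt) (hσ : σ.Nondegenerate) (hσ₁ : σ₁.Nondegenerate) (t : 𝕜) :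
    (formCharpoly (toForm σ hσ) (toForm σ₁ hσ₁) (toForm_nondegenerate σ hσ)).eval t *
      (LinearMap.BilinForm.toMatrix b.dualBasis σ₁).det =
    (t • LinearMap.BilinForm.toMatrix b.dualBasis σ₁ -
      LinearMap.BilinForm.toMatrix b.dualBasis σ).det := by
  set K := LinearMap.BilinForm.symmCompOfNondegenerate (toForm σ₁ hσ₁) (toForm σ hσ)
      (toForm_nondegenerate σ hσ) with hK
  set G := LinearMap.BilinForm.toMatrix b.dualBasis σ with hG
  set G₁ := LinearMap.BilinForm.toMatrix b.dualBasis σ₁ with hG₁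
  have hsharp : ∀ (ρ : LinearMap.BilinForm 𝕜 (Dual 𝕜 V)) i,
      sharp ρ (b.dualBasis i) = ∑ j, LinearMap.BilinForm.toMatrix b.dualBasis ρ i j • b j := by
    intro ρ i
    rw [← b.sum_repr (sharp ρ (b.dualBasis i))]
    refine Finset.sum_congr rfl fun j _ => ?_
    rw [LinearMap.BilinForm.toMatrix_apply, ← apply_sharp, Basis.dualBasis_apply]
  have hmul : G₁ * (LinearMap.toMatrix b b K).transpose = G := by
    ext i l
    have h := symmCompOfNondegenerate_toForm alt alt₁ hσ hσ₁ (b.dualBasis i)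
    rw [hsharp, hsharp, map_sum] at h
    have h2 := congrArg (fun v => b.repr v l) h
    simp only [map_smul, map_sum, Finsupp.coe_finsetSum, Finset.sum_apply, Finsupp.coe_smul,
      Pi.smul_apply, Basis.repr_self, Finsupp.single_apply, smul_eq_mul, mul_ite, mul_one,
      mul_zero, Finset.sum_ite_eq', Finset.mem_univ, if_true] at h2
    rw [Matrix.mul_apply, hG, ← h2]
    simp [LinearMap.toMatrix_apply, hG₁, hK]
  have hch : formCharpoly (toForm σ hσ) (toForm σ₁ hσ₁) (toForm_nondegenerate σ hσ) =
      (LinearMap.toMatrix b b K).transpose.charpoly := by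
    rw [Matrix.charpoly_transpose, LinearMap.charpoly_toMatrix]
    rfl
  rw [hch, Matrix.eval_charpoly, mul_comm, ← Matrix.det_mul, Matrix.mul_sub, hmul]
  congr 2
  ext i j
  simp [mul_comm]

end Charpoly

variable {W : Type*} [AddCommGroup W] [Module 𝕜 W]

theorem wedge_apply (u v : W) (α β : Dual 𝕜 W) : wedge u v α β = α u * β v - α v * β u := by
  simp [wedge]

theorem Decomposition.finrank_eq [FiniteDimensional 𝕜 W]
    {μ μ₁ : LinearMap.BilinForm 𝕜 (Dual 𝕜 W)} (D : Decomposition μ μ₁) :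
    finrank 𝕜 W = finrank 𝕜 D.S + ∑ j, finrank 𝕜 (D.U j) := by
  rw [← (LinearEquiv.ofBijective (DirectSum.coeLinearMap fun o : Option (Fin D.r) =>
    o.elim D.S D.U) D.isInternal).finrank_eq, finrank_directSum,
    Fintype.sum_option]
  rfl

theorem Decomposition.eq_zero_of_restrict_eq_zero
    {μ μ₁ : LinearMap.BilinForm 𝕜 (Dual 𝕜 W)} (D : Decomposition μ μ₁) {α : Dual 𝕜 W}
    (hS : ∀ u : D.S, α u = 0) (hU : ∀ j, ∀ u : D.U j, α u = 0) : α = 0 := by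
  rw [← LinearMap.ker_eq_top, ← top_le_iff, ← D.isInternal.submodule_iSup_eq_top]
  refine iSup_le fun o => ?_
  cases o with
  | none => exact fun u hu => hS ⟨u, hu⟩
  | some j => exact fun u hu => hU j ⟨u, hu⟩

/-- A decomposition gives a block form, whose nondegenerate part has as many rows as the symplectic
factor has dimensions, and determines its characteristic polynomial. -/
theorem Decomposition.exists_blockForm [FiniteDimensional 𝕜 W]
    {μ μ₁ : LinearMap.BilinForm 𝕜 (Dual 𝕜 W)} (D : Decomposition μ μ₁) :
    ∃ F : BlockForm μ μ₁ (finrank 𝕜 D.S), ∀ t,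
      (formCharpoly (toForm D.σ D.nondegenerate) (toForm D.σ₁ D.nondegenerate₁)
        (toForm_nondegenerate D.σ D.nondegenerate)).eval t * F.G₁.det = (t • F.G₁ - F.G).det := by
  choose k e hκ hκ₁ using D.kronecker
  let b := finBasis 𝕜 D.S
  let R : Dual 𝕜 W →ₗ[𝕜] ((Σ j, Fin (k j + 1)) → 𝕜) × ((Σ j, Fin (k j)) → 𝕜) ×
      (Fin (finrank 𝕜 D.S) → 𝕜) :=
    LinearMap.prod
      (LinearMap.pi fun a => Dual.eval 𝕜 W (e a.1 ⟨2 * a.2, by omega⟩ : D.U a.1))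
      (LinearMap.prod
        (LinearMap.pi fun a => Dual.eval 𝕜 W (e a.1 ⟨2 * a.2 + 1, by omega⟩ : D.U a.1))
        (LinearMap.pi fun i => Dual.eval 𝕜 W (b i : D.S)))
  have hR1 : ∀ α a, (R α).1 a = α (e a.1 ⟨2 * a.2, by omega⟩ : D.U a.1) := fun _ _ => rfl
  have hR2 : ∀ α a, (R α).2.1 a = α (e a.1 ⟨2 * a.2 + 1, by omega⟩ : D.U a.1) := fun _ _ => rfl
  have hR3 : ∀ α i, (R α).2.2 i = α (b i : D.S) := fun _ _ => rfl
  have hinj : Function.Injective R := by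
    rw [← LinearMap.ker_eq_bot, LinearMap.ker_eq_bot']
    intro α hα
    have h1 : ∀ a, (R α).1 a = 0 := by simp [hα]
    have h2 : ∀ a, (R α).2.1 a = 0 := by simp [hα]
    have h3 : ∀ a, (R α).2.2 a = 0 := by simp [hα]
    refine D.eq_zero_of_restrict_eq_zero (fun u => ?_) fun j u => ?_
    · have : D.S.subtype.dualMap α = 0 := b.ext h3
      exact LinearMap.congr_fun this u
    · have : (D.U j).subtype.dualMap α = 0 := (e j).ext fun i => by
        rcases Nat.even_or_odd' i.1 with ⟨l, hl | hl⟩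
        · obtain ⟨i, hi⟩ := i
          obtain rfl : i = 2 * l := hl
          exact h1 ⟨j, ⟨l, by omega⟩⟩
        · obtain ⟨i, hi⟩ := i
          obtain rfl : i = 2 * l + 1 := hl
          exact h2 ⟨j, ⟨l, by omega⟩⟩
      exact LinearMap.congr_fun this u
  have hfin : finrank 𝕜 (Dual 𝕜 W) = finrank 𝕜 (((Σ j, Fin (k j + 1)) → 𝕜) ×
      ((Σ j, Fin (k j)) → 𝕜) × (Fin (finrank 𝕜 D.S) → 𝕜)) := by
    rw [Subspace.dual_finrank_eq, D.finrank_eq]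
    simp only [fun j => finrank_eq_card_basis (e j)]
    simp [Finset.sum_add_distrib, two_mul]
    ring
  have hS : ∀ (ρ : LinearMap.BilinForm 𝕜 (Dual 𝕜 D.S)) (α β : Dual 𝕜 W),
      push D.S.subtype ρ α β =
        Matrix.vecMul (R α).2.2 (LinearMap.BilinForm.toMatrix b.dualBasis ρ) ⬝ᵥ (R β).2.2 := by
    intro ρ α β
    have hr : ∀ α : Dual 𝕜 W, ⇑(b.dualBasis.repr (D.S.subtype.dualMap α)) = (R α).2.2 := by
      intro α
      ext i
      simp [hR3]
    rw [← Matrix.dotProduct_mulVec, ← hr, ← hr, ← LinearMap.BilinForm.apply_eq_dotProduct_toMatrix_mulVec]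
    rfl
  refine ⟨{ r := D.r
            k := k
            e := LinearEquiv.ofInjectiveOfFinrankEq R hinj hfin
            G := LinearMap.BilinForm.toMatrix b.dualBasis D.σ
            G₁ := LinearMap.BilinForm.toMatrix b.dualBasis D.σ₁
            det_ne_zero := (LinearMap.BilinForm.nondegenerate_iff_det_ne_zero _).1 D.nondegenerate
            det_ne_zero₁ := (LinearMap.BilinForm.nondegenerate_iff_det_ne_zero _).1 D.nondegenerate₁
            apply_eq := fun α β => ?_
            apply_eq₁ := fun α β => ?_ },
    fun t => eval_formCharpoly_mul_det b D.alt D.alt₁ D.nondegenerate D.nondegenerate₁ t⟩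
  · change μ α β = dropLast k (R α).1 ⬝ᵥ (R β).2.1 - dropLast k (R β).1 ⬝ᵥ (R α).2.1 +
      Matrix.vecMul (R α).2.2 (LinearMap.BilinForm.toMatrix b.dualBasis D.σ) ⬝ᵥ (R β).2.2
    rw [← hS, LinearMap.congr_fun₂ D.eq_sum α β, LinearMap.add_apply, LinearMap.add_apply, add_comm]
    congr 1
    simp only [LinearMap.sum_apply, dotProduct, Fintype.sum_sigma, ← Finset.sum_sub_distrib]
    refine Finset.sum_congr rfl fun j _ => ?_
    simp only [push, hκ, LinearMap.compl₁₂_apply, LinearMap.sum_apply, wedge_apply]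
    refine Finset.sum_congr rfl fun i _ => ?_
    simp [hR1, hR2]
    ring
  · change μ₁ α β = negTail k (R α).1 ⬝ᵥ (R β).2.1 - negTail k (R β).1 ⬝ᵥ (R α).2.1 +
      Matrix.vecMul (R α).2.2 (LinearMap.BilinForm.toMatrix b.dualBasis D.σ₁) ⬝ᵥ (R β).2.2
    rw [← hS, LinearMap.congr_fun₂ D.eq_sum₁ α β, LinearMap.add_apply, LinearMap.add_apply, add_comm]
    congr 1
    simp only [LinearMap.sum_apply, dotProduct, Fintype.sum_sigma, ← Finset.sum_sub_distrib]
    refine Finset.sum_congr rfl fun j _ => ?_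
    simp only [push, hκ₁, LinearMap.compl₁₂_apply, LinearMap.sum_apply, wedge_apply]
    refine Finset.sum_congr rfl fun i _ => ?_
    simp [hR1, hR2, mul_add]
    ring

/-- The block form of a maximal pair with a nontrivial symplectic factor. -/
theorem exists_blockForm_of_isMaximal {W : Type*} [AddCommGroup W] [Module 𝕜 W]
    [FiniteDimensional 𝕜 W] {μ μ₁ : LinearMap.BilinForm 𝕜 (Dual 𝕜 W)} {d r : ℕ} (hd0 : d ≠ 0)
    (hmax : IsMaximal μ μ₁) (hrank : pairRank μ μ₁ + r = finrank 𝕜 W)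
    (hd : symplecticDim μ μ₁ = d) :
    (symplecticCharpoly μ μ₁).Monic ∧ (symplecticCharpoly μ μ₁).natDegree = d ∧
      ∃ F : BlockForm μ μ₁ d, F.r = r ∧
        ∀ t, (symplecticCharpoly μ μ₁).eval t * F.G₁.det = (t • F.G₁ - F.G).det := by
  -- A pair without decomposition has the default dimension 0, which `hd0` excludes.
  have hne : Nonempty (Decomposition μ μ₁) := by
    by_contra hne
    rw [symplecticDim, dif_neg hne] at hd
    exact hd0 hd.symm
  rw [symplecticDim, dif_pos hne] at hd
  subst hd
  have hp : symplecticCharpoly μ μ₁ = _ := dif_pos hne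
  rw [hp]
  refine ⟨LinearMap.charpoly_monic _, LinearMap.charpoly_natDegree _, ?_⟩
  obtain ⟨F, hF⟩ := hne.some.exists_blockForm
  refine ⟨F, ?_, hF⟩
  have h1 := F.finrank_range_add
  rw [Subspace.dual_finrank_eq, ← hrank, ← hmax.1, rank] at h1
  omega

end Decomposition

end Bivector

open Topology

/-! ### Sections of kernels of constant rank, and derivatives of determinants -/

section Calculus

variable {𝕜 : Type*} [RCLike 𝕜] {E : Type*} [NormedAddCommGroup E] [NormedSpace 𝕜 E]

/-- A vector of the kernel of a linear map of locally constant rank extends to a section of the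
kernels. -/
theorem exists_contDiffAt_mem_ker {V W : Type*} [NormedAddCommGroup V] [NormedSpace 𝕜 V]
    [FiniteDimensional 𝕜 V] [NormedAddCommGroup W] [NormedSpace 𝕜 W] [FiniteDimensional 𝕜 W]
    {n : WithTop ℕ∞} {F : E → V →L[𝕜] W} {x₀ : E} (hF : ContDiffAt 𝕜 n F x₀)
    (hcont : ContinuousAt F x₀)
    (hker : ∀ᶠ x in 𝓝 x₀, finrank 𝕜 (F x).ker = finrank 𝕜 (F x₀).ker)
    {v : V} (hv : F x₀ v = 0) :
    ∃ f : E → V, ContDiffAt 𝕜 n f x₀ ∧ f x₀ = v ∧ ∀ᶠ x in 𝓝 x₀, F x (f x) = 0 := by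
  have : CompleteSpace V := FiniteDimensional.complete 𝕜 V
  obtain ⟨C, hC⟩ := Submodule.exists_isCompl (F x₀).ker
  have : CompleteSpace C := FiniteDimensional.complete 𝕜 C
  set R := (F x₀).range with hR
  obtain ⟨π₀, hπ₀⟩ := R.subtype.exists_leftInverse_of_injective R.ker_subtype
  let π : W →L[𝕜] R := LinearMap.toContinuousLinearMap π₀
  have hπ : ∀ u : R, π u = u := fun u => LinearMap.congr_fun hπ₀ u
  -- Restriction to a complement of the kernel at `x₀`, followed by a projection onto the range at
  -- `x₀`: invertible at `x₀`, hence nearby.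
  let Φ : (V →L[𝕜] W) →L[𝕜] (C →L[𝕜] R) :=
    (ContinuousLinearMap.compL 𝕜 C W R π).comp
      ((ContinuousLinearMap.compL 𝕜 C V W).flip C.subtypeL)
  have hΦ : ∀ T u, Φ T u = π (T u) := fun _ _ => rfl
  have hbij : Function.Bijective (Φ (F x₀)) := by
    constructor
    · rw [injective_iff_map_eq_zero]
      intro u hu
      have h1 : F x₀ u = 0 := by
        exact congrArg Subtype.val ((hπ ⟨F x₀ u, ⟨_, rfl⟩⟩).symm.trans hu)
      exact Subtype.ext ((Submodule.disjoint_def.1 hC.disjoint) _ h1 u.2)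
    · rintro ⟨_, y, rfl⟩
      obtain ⟨a, ha, c, hc, rfl⟩ := Submodule.mem_sup.1
        (hC.sup_eq_top ▸ Submodule.mem_top : y ∈ (F x₀).ker ⊔ C)
      refine ⟨⟨c, hc⟩, ?_⟩
      rw [hΦ]
      refine (hπ ⟨F x₀ c, ⟨c, rfl⟩⟩).trans (Subtype.ext ?_)
      change F x₀ c = F x₀ (a + c)
      rw [map_add, show F x₀ a = 0 from ha, zero_add]
  let e₀ : C ≃L[𝕜] R :=
    (LinearEquiv.ofBijective (Φ (F x₀)).toLinearMap hbij).toContinuousLinearEquiv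
  have he₀ : (e₀ : C →L[𝕜] R) = Φ (F x₀) := by ext; rfl
  have hinv : ContDiffAt 𝕜 n (fun x => ContinuousLinearMap.inverse (Φ (F x))) x₀ := by
    have h1 : ContDiffAt 𝕜 n (fun x => Φ (F x)) x₀ := Φ.contDiff.contDiffAt.comp x₀ hF
    have h2 := contDiffAt_map_inverse (𝕜 := 𝕜) (n := n) e₀
    rw [he₀] at h2
    exact h2.comp x₀ h1
  have hev : ∀ᶠ x in 𝓝 x₀, Φ (F x) ∈ Set.range ((↑) : (C ≃L[𝕜] R) → C →L[𝕜] R) := by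
    have h1 : ContinuousAt (fun x => Φ (F x)) x₀ := Φ.continuous.continuousAt.comp hcont
    refine h1.eventually_mem ?_
    rw [← he₀]
    exact ContinuousLinearEquiv.nhds e₀
  -- The vector `v` is corrected inside `C` so that the projection of `F x` on it vanishes.
  refine ⟨fun x => v - C.subtypeL (ContinuousLinearMap.inverse (Φ (F x)) (π (F x v))), ?_, ?_, ?_⟩
  · refine contDiffAt_const.sub (C.subtypeL.contDiff.contDiffAt.comp x₀ (hinv.clm_apply ?_))
    exact π.contDiff.contDiffAt.comp x₀ (hF.clm_apply contDiffAt_const)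
  · simp [hv]
  · filter_upwards [hev, hker] with x ⟨e, he⟩ hx
    set f := v - C.subtypeL (ContinuousLinearMap.inverse (Φ (F x)) (π (F x v))) with hf
    have h1 : f ∈ (π.comp (F x)).ker := by
      have h2 : Φ (F x) (ContinuousLinearMap.inverse (Φ (F x)) (π (F x v))) = π (F x v) := by
        rw [← he, ContinuousLinearMap.inverse_equiv]
        exact e.apply_symm_apply _
      have h3 : (π.comp (F x)) f = 0 := by
        rw [hf, map_sub]
        exact sub_eq_zero.2 h2.symm
      exact h3
    have hle : (F x).ker ≤ (π.comp (F x)).ker := fun u hu => by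
      have hu : F x u = 0 := hu
      have : (π.comp (F x)) u = 0 := by simp [hu]
      exact this
    have hdisj : Disjoint (π.comp (F x)).ker C := by
      rw [Submodule.disjoint_def]
      intro u hu huC
      have h4 : Φ (F x) ⟨u, huC⟩ = 0 := hu
      rw [← he] at h4
      simpa using h4
    -- The kernel of `π ∘ F x` meets `C` trivially, so it is no larger than the kernel of `F x₀`;
    -- constancy of the dimension then makes it equal to the kernel of `F x`.
    have hdim : finrank 𝕜 (π.comp (F x)).ker ≤ finrank 𝕜 (F x).ker := by
      rw [hx]
      have h5 := Submodule.finrank_add_finrank_le_of_disjoint hdisj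
      have h6 := Submodule.finrank_add_eq_of_isCompl hC
      omega
    have heq := Submodule.eq_of_le_of_finrank_le hle hdim
    rw [← heq] at h1
    exact h1

section Det

variable {ι : Type*} [Fintype ι] [DecidableEq ι]

theorem differentiable_det :
    Differentiable 𝕜 fun m : ι → ι → 𝕜 => (Matrix.of m).det := by
  simp only [Matrix.det_apply, Matrix.of_apply]
  fun_prop

theorem contDiff_det {n : WithTop ℕ∞} :
    ContDiff 𝕜 n fun m : ι → ι → 𝕜 => (Matrix.of m).det := by
  simp only [Matrix.det_apply, Matrix.of_apply]
  refine ContDiff.sum fun σ _ => ContDiff.const_smul _ (contDiff_prod fun i _ => ?_)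
  fun_prop

theorem hasDerivAt_det_one_add_smul (Q : Matrix ι ι 𝕜) :
    HasDerivAt (fun s : 𝕜 => (1 + s • Q).det) Q.trace 0 := by
  rw [funext fun s => Matrix.det_one_add_smul s Q]
  set p := (Matrix.det (1 + (Polynomial.X : Polynomial 𝕜) • Q.map Polynomial.C)).divX.divX
  have h1 : HasDerivAt (fun s : 𝕜 => Q.trace * s) Q.trace 0 := by
    simpa using (hasDerivAt_id (0 : 𝕜)).const_mul Q.trace
  have h2 : HasDerivAt (fun s : 𝕜 => p.eval s * s ^ 2) 0 0 := by
    exact ((p.hasDerivAt 0).mul ((hasDerivAt_id (0 : 𝕜)).pow 2)).congr_deriv (by simp)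
  exact ((h1.const_add 1).add h2).congr_deriv (by simp)

theorem fderiv_det_mul (G Q : Matrix ι ι 𝕜) :
    fderiv 𝕜 (fun m : ι → ι → 𝕜 => (Matrix.of m).det) (fun i j => G i j)
      (fun i j => (G * Q) i j) = G.det * Q.trace := by
  set g : ι → ι → 𝕜 := fun i j => G i j
  set m : ι → ι → 𝕜 := fun i j => (G * Q) i j
  have h1 : HasDerivAt (fun s : 𝕜 => G.det * (1 + s • Q).det) (G.det * Q.trace) 0 :=
    (hasDerivAt_det_one_add_smul Q).const_mul _
  have h2 : HasDerivAt (fun s : 𝕜 => g + s • m) m 0 := by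
    simpa using ((hasDerivAt_id (0 : 𝕜)).smul_const m).const_add g
  have h3 : HasFDerivAt (fun m : ι → ι → 𝕜 => (Matrix.of m).det) _ (g + (0 : 𝕜) • m) :=
    (differentiable_det _).hasFDerivAt
  have h4 := h3.comp_hasDerivAt (0 : 𝕜) h2
  rw [zero_smul, add_zero] at h4
  refine h4.unique (h1.congr_of_eventuallyEq (Filter.Eventually.of_forall fun s => ?_))
  change (G + s • (G * Q)).det = G.det * (1 + s • Q).det
  rw [← Matrix.det_mul, Matrix.mul_add, Matrix.mul_one, Matrix.mul_smul]

theorem fderiv_det_mul' (G Q : Matrix ι ι 𝕜) :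
    fderiv 𝕜 (fun m : ι → ι → 𝕜 => (Matrix.of m).det) (fun i j => G i j)
      (fun i j => (Q * G) i j) = G.det * Q.trace := by
  set g : ι → ι → 𝕜 := fun i j => G i j
  set m : ι → ι → 𝕜 := fun i j => (Q * G) i j
  have h1 : HasDerivAt (fun s : 𝕜 => (1 + s • Q).det * G.det) (Q.trace * G.det) 0 :=
    (hasDerivAt_det_one_add_smul Q).mul_const _
  have h2 : HasDerivAt (fun s : 𝕜 => g + s • m) m 0 := by
    simpa using ((hasDerivAt_id (0 : 𝕜)).smul_const m).const_add g
  have h3 : HasFDerivAt (fun m : ι → ι → 𝕜 => (Matrix.of m).det) _ (g + (0 : 𝕜) • m) :=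
    (differentiable_det _).hasFDerivAt
  have h4 := h3.comp_hasDerivAt (0 : 𝕜) h2
  rw [zero_smul, add_zero] at h4
  rw [mul_comm]
  refine h4.unique (h1.congr_of_eventuallyEq (Filter.Eventually.of_forall fun s => ?_))
  change (G + s • (Q * G)).det = (1 + s • Q).det * G.det
  rw [← Matrix.det_mul, Matrix.add_mul, Matrix.one_mul, Matrix.smul_mul]

end Det

end Calculus

/-! ### Hamiltonian vector field of a Gram determinant -/

section Gram

set_option maxSynthPendingDepth 3

variable {𝕜 : Type*} [RCLike 𝕜] {E : Type*} [NormedAddCommGroup E] [NormedSpace 𝕜 E]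

theorem exists_forall_apply_eq [FiniteDimensional 𝕜 E] (l : (E →L[𝕜] 𝕜) →ₗ[𝕜] 𝕜) :
    ∃ v : E, ∀ β : (E →L[𝕜] 𝕜), l β = β v := by
  refine ⟨(evalEquiv 𝕜 E).symm (l ∘ₗ (LinearMap.toContinuousLinearMap :
    (E →ₗ[𝕜] 𝕜) ≃ₗ[𝕜] (E →L[𝕜] 𝕜)).toLinearMap), fun β => ?_⟩
  have h := Module.apply_evalEquiv_symm_apply 𝕜 E β.toLinearMap
    (l ∘ₗ (LinearMap.toContinuousLinearMap : (E →ₗ[𝕜] 𝕜) ≃ₗ[𝕜] (E →L[𝕜] 𝕜)).toLinearMap)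
  exact h.symm

variable {ι : Type*} [Fintype ι] [DecidableEq ι]

/-- The derivative of the determinant along a direction of the form `-(G Q + Qᵀ G)`. -/
theorem fderiv_det_apply {G : E → ι → ι → 𝕜} {x₀ : E} (hG : DifferentiableAt 𝕜 G x₀) {w : E}
    (Q : Matrix ι ι 𝕜)
    (h : ∀ i j, fderiv 𝕜 G x₀ w i j = -(∑ k, G x₀ i k * Q k j) - ∑ k, Q k i * G x₀ k j) :
    fderiv 𝕜 (fun x => (Matrix.of (G x)).det) x₀ w =
      -2 * (Matrix.of (G x₀)).det * Q.trace := by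
  have h1 : fderiv 𝕜 (fun x => (Matrix.of (G x)).det) x₀ =
      (fderiv 𝕜 (fun m : ι → ι → 𝕜 => (Matrix.of m).det) (G x₀)).comp (fderiv 𝕜 G x₀) :=
    ((differentiable_det (G x₀)).hasFDerivAt.comp x₀ hG.hasFDerivAt).fderiv
  have h2 : fderiv 𝕜 G x₀ w = -(fun i j => (Matrix.of (G x₀) * Q) i j) -
      fun i j => (Q.transpose * Matrix.of (G x₀)) i j := by
    ext i j
    simp [h, Matrix.mul_apply]
  -- Each of the terms G Q and Qᵀ G contributes det G · tr Q, whence the factor 2.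
  have h3 := fderiv_det_mul (Matrix.of (G x₀)) Q
  have h4 := fderiv_det_mul' (Matrix.of (G x₀)) Q.transpose
  simp only [Matrix.of_apply] at h3 h4
  rw [h1, ContinuousLinearMap.comp_apply, h2, map_sub, map_neg]
  refine (congrArg₂ (fun a b => -a - b) h3 h4).trans ?_
  rw [Matrix.trace_transpose]
  ring

variable {A : E → (E →L[𝕜] 𝕜) →L[𝕜] (E →L[𝕜] 𝕜) →L[𝕜] 𝕜} {x₀ : E}

/-- The Hamiltonian vector field of the Gram determinant of a family `η` of `1`-forms, for a field
`A` of bivectors that satisfies the Jacobi identity at `x₀`, when `A` maps the family `η` into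
the span of a family `e` of vectors. -/
theorem apply_fderiv_det_gram [FiniteDimensional 𝕜 E] (hA : DifferentiableAt 𝕜 A x₀)
    (alt : ∀ x α β, A x α β = -A x β α)
    (jac : ∀ α β γ, A x₀ α (fderiv 𝕜 (fun x => A x β γ) x₀) +
      A x₀ β (fderiv 𝕜 (fun x => A x γ α) x₀) + A x₀ γ (fderiv 𝕜 (fun x => A x α β) x₀) = 0)
    {η : ι → E → (E →L[𝕜] 𝕜)} (hη : ∀ i, DifferentiableAt 𝕜 (η i) x₀) {e : ι → E}
    (he : ∀ i β, A x₀ (η i x₀) β = ∑ k, A x₀ (η i x₀) (η k x₀) * β (e k))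
    (γ : (E →L[𝕜] 𝕜)) :
    A x₀ γ (fderiv 𝕜 (fun x => (Matrix.of fun i j => A x (η i x) (η j x)).det) x₀) =
      -2 * (Matrix.of fun i j => A x₀ (η i x₀) (η j x₀)).det *
        ∑ j, (fderiv 𝕜 A x₀ (e j) (η j x₀) γ -
          A x₀ γ (fderiv 𝕜 (fun x => η j x (e j)) x₀)) := by
  obtain ⟨w, hw⟩ := exists_forall_apply_eq (A x₀ γ).toLinearMap
  replace hw : ∀ β, A x₀ γ β = β w := hw
  have hAc : ∀ β γ : (E →L[𝕜] 𝕜), ∀ v,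
      fderiv 𝕜 (fun x => A x β γ) x₀ v = fderiv 𝕜 A x₀ v β γ := by
    intro β γ v
    have := (hA.hasFDerivAt.clm_apply (hasFDerivAt_const β x₀)).clm_apply (hasFDerivAt_const γ x₀)
    rw [this.fderiv]
    simp
  have hηc : ∀ j v u, fderiv 𝕜 (fun x => η j x v) x₀ u = fderiv 𝕜 (η j) x₀ u v := by
    intro j v u
    have := (hη j).hasFDerivAt.clm_apply (hasFDerivAt_const v x₀)
    rw [this.fderiv]
    simp
  have hGd : ∀ i j, HasFDerivAt (fun x => A x (η i x) (η j x)) _ x₀ := fun i j =>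
    (hA.hasFDerivAt.clm_apply (hη i).hasFDerivAt).clm_apply (hη j).hasFDerivAt
  have hG : HasFDerivAt (fun x i j => A x (η i x) (η j x)) _ x₀ :=
    hasFDerivAt_pi.2 fun i => hasFDerivAt_pi.2 fun j => hGd i j
  have hGw : ∀ i j, fderiv 𝕜 (fun x i j => A x (η i x) (η j x)) x₀ w i j =
      fderiv 𝕜 A x₀ w (η i x₀) (η j x₀) + A x₀ (fderiv 𝕜 (η i) x₀ w) (η j x₀) +
        A x₀ (η i x₀) (fderiv 𝕜 (η j) x₀ w) := by
    intro i j
    rw [hG.fderiv]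
    simp
    ring
  have haltd : ∀ v β γ, fderiv 𝕜 A x₀ v β γ = -fderiv 𝕜 A x₀ v γ β := by
    intro v β γ
    rw [← hAc, ← hAc, funext fun x => alt x β γ, fderiv_fun_neg]
    rfl
  -- The derivative of the Gram matrix G along the vector `w` = A(γ, ·) is -(G Q + Qᵀ G). The Jacobi
  -- identity replaces the derivative of A along `w` by derivatives contracted with A(η_i, ·), and
  -- these vectors, like those met in differentiating η, expand in `e` with coefficients from G.
  let Q : Matrix ι ι 𝕜 := Matrix.of fun k j =>
    fderiv 𝕜 A x₀ (e k) (η j x₀) γ - fderiv 𝕜 (η j) x₀ w (e k)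
  rw [hw, fderiv_det_apply hG.differentiableAt Q]
  · simp only [Matrix.trace, Matrix.diag, Q, Matrix.of_apply, hw, hηc]
  · intro i j
    rw [hGw]
    have hj := jac γ (η i x₀) (η j x₀)
    rw [hw, he, he, hAc] at hj
    have h2 : A x₀ (fderiv 𝕜 (η i) x₀ w) (η j x₀) = -A x₀ (η j x₀) (fderiv 𝕜 (η i) x₀ w) :=
      alt _ _ _
    rw [h2, he i, he j]
    simp only [hAc] at hj
    have h3 : ∀ k, A x₀ (η k x₀) (η j x₀) = -A x₀ (η j x₀) (η k x₀) := fun k => alt _ _ _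
    simp only [h3, Q, Matrix.of_apply, mul_sub, sub_mul, Finset.sum_sub_distrib, mul_neg,
      Finset.sum_neg_distrib]
    have h4 : ∀ k, fderiv 𝕜 A x₀ (e k) (η i x₀) γ * A x₀ (η j x₀) (η k x₀) =
        -(A x₀ (η j x₀) (η k x₀) * fderiv 𝕜 A x₀ (e k) γ (η i x₀)) := fun k => by
      rw [haltd _ (η i x₀) γ]
      ring
    simp only [h4, Finset.sum_neg_distrib, mul_comm (fderiv 𝕜 (η i) x₀ w _)]
    linear_combination hj

end Gram

/-! ### The Lenard recursion and its consequences -/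

namespace Bivector

section Recursion

variable {𝕜 : Type*} [Field 𝕜] [Infinite 𝕜] {V : Type*} [AddCommGroup V] [Module 𝕜 V]
  {μ μ₁ : LinearMap.BilinForm 𝕜 V} {d : ℕ} {θ : ℕ → V} {p : Polynomial 𝕜}

open Polynomial in
/-- Comparison of coefficients in `(t μ₁ - μ)(γ, ∑ tʲ θ j) = p(t) (a + b t)`. -/
theorem exists_recursion (hθ : ∀ j, d ≤ j → θ j = 0) (hp : p.Monic) (hd : p.natDegree = d)
    (γ : V) {a b : 𝕜}
    (h : ∀ t : 𝕜, t * μ₁ γ (∑ j ∈ Finset.range d, t ^ j • θ j) -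
      μ γ (∑ j ∈ Finset.range d, t ^ j • θ j) = p.eval t * (a + t * b)) :
    b = 0 ∧ -μ γ (θ 0) = p.coeff 0 * a ∧
      ∀ j, μ₁ γ (θ j) - μ γ (θ (j + 1)) = p.coeff (j + 1) * a := by
  set Q : Polynomial 𝕜 := ∑ j ∈ Finset.range d, C (μ γ (θ j)) * X ^ j with hQ
  set Q₁ : Polynomial 𝕜 := ∑ j ∈ Finset.range d, C (μ₁ γ (θ j)) * X ^ j with hQ₁
  have hc : ∀ (ν : LinearMap.BilinForm 𝕜 V) j,
      (∑ j ∈ Finset.range d, C (ν γ (θ j)) * X ^ j).coeff j = ν γ (θ j) := by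
    intro ν j
    simp only [finsetSum_coeff, coeff_C_mul, coeff_X_pow, mul_ite, mul_one, mul_zero,
      Finset.sum_ite_eq, Finset.mem_range]
    split_ifs with hj
    · rfl
    · rw [hθ j (not_lt.1 hj), map_zero]
  have hpoly : X * Q₁ - Q = p * (C a + X * C b) := by
    refine Polynomial.funext fun t => ?_
    have h' := h t
    simp only [map_sum, map_smul, smul_eq_mul] at h'
    simp only [eval_sub, eval_mul, eval_X, hQ₁, hQ, eval_finsetSum, eval_C, eval_pow, eval_add]
    rw [← h']
    simp only [mul_comm (t ^ _)]
  -- Degree d + 1: the left side has degree at most d, and p is monic of degree d.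
  have hb : b = 0 := by
    have h1 := congrArg (fun q => q.coeff (d + 1)) hpoly
    simp only [coeff_sub, coeff_X_mul, hQ₁, hQ, hc, mul_add, coeff_add, coeff_mul_C] at h1
    rw [← mul_assoc, coeff_mul_C, coeff_mul_X, hθ d le_rfl, hθ (d + 1) (Nat.le_succ d),
      coeff_eq_zero_of_natDegree_lt (hd ▸ Nat.lt_succ_self d), ← hd, hp.coeff_natDegree] at h1
    simpa using h1.symm
  subst hb
  rw [C_0, mul_zero, add_zero] at hpoly
  refine ⟨rfl, ?_, ?_⟩
  · have h1 := congrArg (fun q => q.coeff 0) hpoly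
    simpa [hQ, hc] using h1
  · intro j
    have h1 := congrArg (fun q => q.coeff (j + 1)) hpoly
    simpa [hQ, hQ₁, hc] using h1

/-- A pair of skew forms and covectors that satisfy a recursion of Lenard type. -/
theorem involution_and_span_eq (alt : ∀ α β, μ α β = -μ β α) (alt₁ : ∀ α β, μ₁ α β = -μ₁ β α)
    (h2 : (2 : 𝕜) ≠ 0)
    (hθ : ∀ j, d ≤ j → θ j = 0) (hp : p.Monic) (hd : p.natDegree = d) (hp0 : p.eval 0 ≠ 0)
    (h : ∀ γ, ∃ a b : 𝕜, ∀ t : 𝕜, t * μ₁ γ (∑ j ∈ Finset.range d, t ^ j • θ j) -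
      μ γ (∑ j ∈ Finset.range d, t ^ j • θ j) = p.eval t * (a + t * b)) :
    (∀ i j, μ (θ i) (θ j) = 0 ∧ μ₁ (θ i) (θ j) = 0) ∧
    Submodule.span 𝕜 (Set.range fun j : Fin d => μ (θ j)) =
      Submodule.span 𝕜 (Set.range fun j : Fin d => μ₁ (θ j)) := by
  rcases Nat.eq_zero_or_pos d with rfl | hdpos
  · refine ⟨fun i j => ?_, ?_⟩
    · simp [hθ j (Nat.zero_le j)]
    · simp [Set.range_eq_empty]
  have hself : ∀ {ν : LinearMap.BilinForm 𝕜 V}, (∀ α β, ν α β = -ν β α) → ∀ α, ν α α = 0 := by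
    intro ν hν α
    have := hν α α
    have h3 : 2 * ν α α = 0 := by linear_combination this
    exact (mul_eq_zero.1 h3).resolve_left h2
  -- The coefficient of degree d identifies a, again because p is monic.
  have hlast : ∀ γ a, (∀ j, μ₁ γ (θ j) - μ γ (θ (j + 1)) = p.coeff (j + 1) * a) →
      a = μ₁ γ (θ (d - 1)) := by
    intro γ a ha
    have h3 := ha (d - 1)
    rw [Nat.sub_add_cancel hdpos, hθ d le_rfl, map_zero, sub_zero, ← hd, hp.coeff_natDegree,
      one_mul] at h3
    rw [← hd, h3]
  have hrec : ∀ γ, -μ γ (θ 0) = p.coeff 0 * μ₁ γ (θ (d - 1)) ∧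
      ∀ j, μ₁ γ (θ j) - μ γ (θ (j + 1)) = p.coeff (j + 1) * μ₁ γ (θ (d - 1)) := by
    intro γ
    obtain ⟨a, b, hab⟩ := h γ
    have h3 := exists_recursion hθ hp hd γ hab
    have h4 := hlast γ a h3.2.2
    rw [← h4]
    exact h3.2
  -- For γ = ∑ tʲ θ j the left side vanishes by skew-symmetry, leaving p(t) μ₁(γ, θ (d - 1)) = 0 for
  -- every t; the nonzero polynomial p cancels.
  have hzero : ∀ j, μ₁ (θ j) (θ (d - 1)) = 0 := by
    set R : Polynomial 𝕜 := ∑ j ∈ Finset.range d,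
      Polynomial.C (μ₁ (θ j) (θ (d - 1))) * Polynomial.X ^ j with hR
    have hpR : p * R = 0 := by
      refine Polynomial.funext fun t => ?_
      set f := ∑ j ∈ Finset.range d, t ^ j • θ j with hf
      obtain ⟨a, b, hab⟩ := h f
      have h3 := exists_recursion hθ hp hd f hab
      have h4 := hlast f a h3.2.2
      have h5 := hab t
      rw [← hf, hself alt, hself alt₁, h3.1, h4, hf] at h5
      simp only [map_sum, LinearMap.sum_apply, map_smul, LinearMap.smul_apply, smul_eq_mul,
        mul_zero, sub_zero, add_zero] at h5
      simp only [hR, Polynomial.eval_mul, Polynomial.eval_finsetSum, Polynomial.eval_C,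
        Polynomial.eval_pow, Polynomial.eval_X, Polynomial.eval_zero, mul_comm _ (t ^ _)]
      exact h5.symm
    have hR0 : R = 0 := (mul_eq_zero.1 hpR).resolve_left hp.ne_zero
    intro j
    rcases lt_or_ge j d with hj | hj
    · have h3 := congrArg (fun q => q.coeff j) hR0
      simpa [hR, Polynomial.finsetSum_coeff, Polynomial.coeff_X_pow, hj] using h3
    · simp [hθ j hj]
  have hrec0 : ∀ i, μ (θ i) (θ 0) = 0 := fun i => by
    simpa [hzero] using (hrec (θ i)).1
  have hrec1 : ∀ i j, μ₁ (θ i) (θ j) = μ (θ i) (θ (j + 1)) := fun i j => by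
    simpa [hzero, sub_eq_zero] using (hrec (θ i)).2 j
  -- By `hrec1` and skew-symmetry, μ₁(θ (i + 1), θ j) = μ₁(θ i, θ (j + 1)), so the first index
  -- descends to 0, where `hrec0` applies.
  have hinv₁ : ∀ i j, μ₁ (θ i) (θ j) = 0 := by
    intro i
    induction i with
    | zero => intro j; rw [hrec1, alt, hrec0, neg_zero]
    | succ i ih => intro j; rw [hrec1, alt, ← hrec1, alt₁, ih, neg_zero, neg_zero]
  refine ⟨fun i j => ⟨?_, hinv₁ i j⟩, ?_⟩
  · cases j with
    | zero => exact hrec0 i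
    | succ j => rw [← hrec1, hinv₁]
  set X := μ₁ (θ (d - 1)) with hX
  have hdual0 : μ (θ 0) = -p.coeff 0 • X := by
    ext γ
    have h3 := (hrec γ).1
    rw [alt γ, alt₁ γ] at h3
    rw [LinearMap.smul_apply, smul_eq_mul, hX]
    linear_combination h3
  have hdual1 : ∀ j, μ₁ (θ j) - μ (θ (j + 1)) = p.coeff (j + 1) • X := by
    intro j
    ext γ
    have h3 := (hrec γ).2 j
    rw [alt γ, alt₁ γ, alt₁ γ] at h3
    rw [LinearMap.smul_apply, smul_eq_mul, hX, LinearMap.sub_apply]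
    linear_combination -h3
  have hmem : ∀ (ν : LinearMap.BilinForm 𝕜 V) j,
      ν (θ j) ∈ Submodule.span 𝕜 (Set.range fun j : Fin d => ν (θ j)) := by
    intro ν j
    rcases lt_or_ge j d with hj | hj
    · exact Submodule.subset_span ⟨⟨j, hj⟩, rfl⟩
    · rw [hθ j hj, map_zero]
      exact Submodule.zero_mem _
  -- This inclusion needs p(0) ≠ 0, to recover X from μ(θ 0).
  have hXmem : X ∈ Submodule.span 𝕜 (Set.range fun j : Fin d => μ (θ j)) := by
    have h3 : X = -(p.coeff 0)⁻¹ • μ (θ 0) := by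
      have hc : p.coeff 0 ≠ 0 := by rwa [Polynomial.coeff_zero_eq_eval_zero]
      rw [hdual0, smul_smul, neg_mul_neg, inv_mul_cancel₀ hc, one_smul]
    rw [h3]
    exact Submodule.smul_mem _ _ (hmem μ 0)
  apply le_antisymm
  · rw [Submodule.span_le]
    rintro _ ⟨⟨j, hj⟩, rfl⟩
    cases j with
    | zero =>
      simp only [hdual0]
      exact Submodule.smul_mem _ _ (hmem μ₁ _)
    | succ j =>
      have h3 : μ (θ (j + 1)) = μ₁ (θ j) - p.coeff (j + 1) • X := by
        rw [← hdual1]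
        abel
      simp only [h3]
      exact Submodule.sub_mem _ (hmem μ₁ _) (Submodule.smul_mem _ _ (hmem μ₁ _))
  · rw [Submodule.span_le]
    rintro _ ⟨⟨j, hj⟩, rfl⟩
    have h3 : μ₁ (θ j) = μ (θ (j + 1)) + p.coeff (j + 1) • X := by
      rw [← hdual1]
      abel
    simp only [h3]
    exact Submodule.add_mem _ (hmem μ _) (Submodule.smul_mem _ _ hXmem)

end Recursion

end Bivector

/-! ### Gram matrices of covectors without odd Kronecker component -/

namespace Bivector

section GramMatrix

variable {𝕜 : Type*} [Field 𝕜] {V : Type*} [AddCommGroup V] [Module 𝕜 V]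
  {μ μ₁ : LinearMap.BilinForm 𝕜 V} {d : ℕ}

theorem BlockForm.gram_eq (F : BlockForm μ μ₁ d) {v : Fin d → V}
    (hv : ∀ i, (F.e (v i)).2.1 = 0) :
    (Matrix.of fun i j => μ (v i) (v j)) =
      (Matrix.of fun i => (F.e (v i)).2.2) * F.G * (Matrix.of fun i => (F.e (v i)).2.2).transpose ∧
    (Matrix.of fun i j => μ₁ (v i) (v j)) =
      (Matrix.of fun i => (F.e (v i)).2.2) * F.G₁ *
        (Matrix.of fun i => (F.e (v i)).2.2).transpose := by
  constructor
  · ext i j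
    rw [Matrix.of_apply, F.apply_eq, hv, hv, dotProduct_zero, dotProduct_zero, sub_zero, zero_add]
    rfl
  · ext i j
    rw [Matrix.of_apply, F.apply_eq₁, hv, hv, dotProduct_zero, dotProduct_zero, sub_zero, zero_add]
    rfl

/-- With Z the matrix of symplectic components of the family, both Gram determinants acquire the
same factor (det Z)², and Z need not be invertible. -/
theorem BlockForm.eval_mul_det_gram (F : BlockForm μ μ₁ d) {p : Polynomial 𝕜} {t : 𝕜}
    (hp : p.eval t * F.G₁.det = (t • F.G₁ - F.G).det) {v : Fin d → V}
    (hv : ∀ i, (F.e (v i)).2.1 = 0) :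
    p.eval t * (Matrix.of fun i j => μ₁ (v i) (v j)).det =
      (Matrix.of fun i j => t * μ₁ (v i) (v j) - μ (v i) (v j)).det := by
  have h : (Matrix.of fun i j => t * μ₁ (v i) (v j) - μ (v i) (v j)) =
      t • (Matrix.of fun i j => μ₁ (v i) (v j)) - Matrix.of fun i j => μ (v i) (v j) := rfl
  rw [h, (F.gram_eq hv).1, (F.gram_eq hv).2]
  set Z : Matrix (Fin d) (Fin d) 𝕜 := Matrix.of fun i => (F.e (v i)).2.2
  have h2 : t • (Z * F.G₁ * Z.transpose) - Z * F.G * Z.transpose =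
      Z * (t • F.G₁ - F.G) * Z.transpose := by
    simp only [Matrix.mul_sub, Matrix.sub_mul, Matrix.mul_smul, Matrix.smul_mul]
  rw [h2, Matrix.det_mul, Matrix.det_mul, Matrix.det_mul, Matrix.det_mul, ← hp]
  ring

end GramMatrix

end Bivector

open Bivector

/-! ### The theorem in an open subset of a vector space -/

section Local

set_option maxSynthPendingDepth 3

variable {𝕜 : Type*} [RCLike 𝕜] {E : Type*} [NormedAddCommGroup E] [NormedSpace 𝕜 E]
  {P P₁ : E → (E →L[𝕜] 𝕜) →L[𝕜] (E →L[𝕜] 𝕜) →L[𝕜] 𝕜} {x₀ : E} {d r : ℕ}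

/-- The chain map of a pair of continuous bilinear forms. -/
def continuousChainMap {V : Type*} [NormedAddCommGroup V] [NormedSpace 𝕜 V] (N : ℕ)
    (Q Q₁ : V →L[𝕜] V →L[𝕜] 𝕜) : (Fin (N + 1) → V) →L[𝕜] (Fin N → V →L[𝕜] 𝕜) :=
  ∑ i : Fin N, (ContinuousLinearMap.single 𝕜 (fun _ : Fin N => V →L[𝕜] 𝕜) i).comp
    (Q.comp (ContinuousLinearMap.proj i.castSucc) - Q₁.comp (ContinuousLinearMap.proj i.succ))

theorem ker_continuousChainMap {V : Type*} [NormedAddCommGroup V] [NormedSpace 𝕜 V] (N : ℕ)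
    (Q Q₁ : V →L[𝕜] V →L[𝕜] 𝕜) :
    (continuousChainMap N Q Q₁).ker = LinearMap.ker (chainMap Q.toBilinForm Q₁.toBilinForm N) := by
  ext c
  rw [mem_ker_chainMap]
  have h : ∀ i, continuousChainMap N Q Q₁ c i = Q (c i.castSucc) - Q₁ (c i.succ) := by
    intro i
    simp [continuousChainMap, Finset.sum_apply, Pi.single_apply]
  rw [LinearMap.mem_ker, ContinuousLinearMap.coe_coe, funext_iff]
  refine forall_congr' fun i => ?_
  rw [h, Pi.zero_apply, sub_eq_zero, ContinuousLinearMap.ext_iff]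
  rfl

/-- A frame of the symplectic part of a pencil of locally constant type at a point extends to a
family of smooth `1`-forms without component in the odd part of the Kronecker blocks. -/
theorem exists_frame [FiniteDimensional 𝕜 E] (hP : ContDiffAt 𝕜 ∞ P x₀) (hP₁ : ContDiffAt 𝕜 ∞ P₁ x₀)
    (hF : ∀ᶠ x in 𝓝 x₀,
      ∃ F : BlockForm (P x).toBilinForm (P₁ x).toBilinForm d, F.r = r)
    (F₀ : BlockForm (P x₀).toBilinForm (P₁ x₀).toBilinForm d) (hr : F₀.r = r) :
    ∃ η : Fin d → E → (E →L[𝕜] 𝕜), (∀ i, ContDiffAt 𝕜 ∞ (η i) x₀) ∧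
      (∀ i, F₀.e (η i x₀) = (0, 0, Pi.single i 1)) ∧
      ∀ᶠ x in 𝓝 x₀, ∀ F : BlockForm (P x).toBilinForm (P₁ x).toBilinForm d, F.r = r →
        ∀ i, (F.e (η i x)).2.1 = 0 := by
  set N := F₀.size with hN
  -- The sizes of the blocks may vary with x, but their sum is determined by r, d and the dimension,
  -- so a single N serves all nearby points.
  have hsize : ∀ x, ∀ F : BlockForm (P x).toBilinForm (P₁ x).toBilinForm d, F.r = r →
      F.size = N := by
    intro x F hFr
    have h1 := F.finrank_eq
    have h2 := F₀.finrank_eq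
    omega
  let T : E → (Fin (N + 1) → (E →L[𝕜] 𝕜)) →L[𝕜] (Fin N → (E →L[𝕜] 𝕜) →L[𝕜] 𝕜) :=
    fun x => continuousChainMap N (P x) (P₁ x)
  have hT : ContDiffAt 𝕜 ∞ T x₀ := by
    refine ContDiffAt.sum fun i _ => contDiffAt_const.clm_comp ?_
    exact (hP.clm_comp contDiffAt_const).sub (hP₁.clm_comp contDiffAt_const)
  have hdim : ∀ x, ∀ F : BlockForm (P x).toBilinForm (P₁ x).toBilinForm d, F.r = r →
      finrank 𝕜 (T x).ker + N * N = (N + 1) * (N + r) + d := by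
    intro x F hFr
    have h1 := F.finrank_ker_chainMap (hsize x F hFr).le
    rw [hFr, hsize x F hFr] at h1
    rw [ker_continuousChainMap]
    exact h1
  have hker : ∀ᶠ x in 𝓝 x₀, finrank 𝕜 (T x).ker = finrank 𝕜 (T x₀).ker := by
    filter_upwards [hF] with x ⟨F, hFr⟩
    have h1 := hdim x F hFr
    have h2 := hdim x₀ F₀ hr
    omega
  have hext : ∀ i : Fin d, ∃ f : E → Fin (N + 1) → (E →L[𝕜] 𝕜), ContDiffAt 𝕜 ∞ f x₀ ∧
      F₀.e (f x₀ 0) = (0, 0, Pi.single i 1) ∧ ∀ᶠ x in 𝓝 x₀, T x (f x) = 0 := by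
    intro i
    obtain ⟨c, hc, hc0⟩ := F₀.exists_chain le_rfl (Pi.single i 1)
    rw [← ker_continuousChainMap] at hc
    obtain ⟨f, hf, hf0, hfk⟩ := exists_contDiffAt_mem_ker hT hT.continuousAt hker hc
    exact ⟨f, hf, by rw [hf0]; exact hc0, hfk⟩
  choose f hf hf0 hfk using hext
  refine ⟨fun i x => f i x 0, fun i => contDiffAt_pi.1 (hf i) 0, hf0, ?_⟩
  filter_upwards [Filter.eventually_all.2 hfk] with x hx F hFr i
  refine F.chain_zero_snd (hsize x F hFr).le (N := N) ?_ 0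
  rw [← ker_continuousChainMap]
  exact hx i

theorem contDiffAt_det_gram {A : E → (E →L[𝕜] 𝕜) →L[𝕜] (E →L[𝕜] 𝕜) →L[𝕜] 𝕜}
    (hA : ContDiffAt 𝕜 ∞ A x₀) {η : Fin d → E → (E →L[𝕜] 𝕜)}
    (hη : ∀ i, ContDiffAt 𝕜 ∞ (η i) x₀) :
    ContDiffAt 𝕜 ∞ (fun x => (Matrix.of fun i j => A x (η i x) (η j x)).det) x₀ :=
  contDiff_det.contDiffAt.comp x₀ (contDiffAt_pi.2 fun i => contDiffAt_pi.2 fun j =>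
    (hA.clm_apply (hη i)).clm_apply (hη j))

/-- The Jacobi identity at `x₀` for a field of bivectors. -/
def JacobiAt (A : E → (E →L[𝕜] 𝕜) →L[𝕜] (E →L[𝕜] 𝕜) →L[𝕜] 𝕜) (x₀ : E) : Prop :=
  ∀ α β γ, A x₀ α (fderiv 𝕜 (fun x => A x β γ) x₀) +
    A x₀ β (fderiv 𝕜 (fun x => A x γ α) x₀) + A x₀ γ (fderiv 𝕜 (fun x => A x α β) x₀) = 0

/-- The Jacobi expression is quadratic in the bivector. Its values at P, P₁ and P + P₁ determine the
mixed term, hence its value on the whole pencil. -/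
theorem JacobiAt.pencil (hP : DifferentiableAt 𝕜 P x₀) (hP₁ : DifferentiableAt 𝕜 P₁ x₀)
    (h : JacobiAt P x₀) (h₁ : JacobiAt P₁ x₀) (h₂ : JacobiAt (fun x => P x + P₁ x) x₀) (t : 𝕜) :
    JacobiAt (fun x => t • P₁ x - P x) x₀ := by
  have hd : ∀ {A : E → (E →L[𝕜] 𝕜) →L[𝕜] (E →L[𝕜] 𝕜) →L[𝕜] 𝕜}, DifferentiableAt 𝕜 A x₀ →
      ∀ α β, DifferentiableAt 𝕜 (fun x => A x α β) x₀ := fun hA α β =>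
    (hA.clm_apply (differentiableAt_const _)).clm_apply (differentiableAt_const _)
  have hadd : ∀ α β, fderiv 𝕜 (fun x => (P x + P₁ x) α β) x₀ =
      fderiv 𝕜 (fun x => P x α β) x₀ + fderiv 𝕜 (fun x => P₁ x α β) x₀ := fun α β =>
    fderiv_fun_add (hd hP α β) (hd hP₁ α β)
  have hsub : ∀ α β, fderiv 𝕜 (fun x => (t • P₁ x - P x) α β) x₀ =
      t • fderiv 𝕜 (fun x => P₁ x α β) x₀ - fderiv 𝕜 (fun x => P x α β) x₀ := fun α β =>
    (((hd hP₁ α β).hasFDerivAt.const_smul t).sub (hd hP α β).hasFDerivAt).fderiv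
  intro α β γ
  have e := h α β γ
  have e₁ := h₁ α β γ
  have e₂ := h₂ α β γ
  simp only [hadd] at e₂
  simp only [hsub]
  simp only [add_apply, map_add] at e₂
  simp only [sub_apply, smul_apply, map_sub, map_smul, smul_eq_mul]
  linear_combination (t ^ 2 + t) * e₁ + (1 + t) * e - t * e₂

/-- Polynomials of bounded degree depend smoothly on a parameter when their values do. -/
theorem contDiffAt_coeff {p : E → Polynomial 𝕜} (hdeg : ∀ᶠ x in 𝓝 x₀, (p x).natDegree = d)
    (hp : ∀ t, ContDiffAt 𝕜 ∞ (fun x => (p x).eval t) x₀) (j : ℕ) :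
    ContDiffAt 𝕜 ∞ (fun x => (p x).coeff j) x₀ := by
  -- Lagrange interpolation at the d + 1 nodes 0, …, d writes the coefficients as fixed linear
  -- combinations of values.
  let v : ℕ → 𝕜 := fun i => i
  have hv : Set.InjOn v (Finset.range (d + 1)) := fun a _ b _ hab => Nat.cast_injective hab
  have h : (fun x => ∑ i ∈ Finset.range (d + 1),
      (p x).eval (v i) * (Lagrange.basis (Finset.range (d + 1)) v i).coeff j) =ᶠ[𝓝 x₀]
      fun x => (p x).coeff j := by
    filter_upwards [hdeg] with x hx
    have h1 := Lagrange.eq_interpolate (f := p x) hv (by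
      refine lt_of_le_of_lt Polynomial.degree_le_natDegree ?_
      rw [hx, Finset.card_range]
      exact_mod_cast Nat.lt_succ_self d)
    conv_rhs => rw [h1, Lagrange.interpolate_apply]
    simp [Polynomial.finsetSum_coeff]
  refine ContDiffAt.congr_of_eventuallyEq ?_ h.symm
  exact ContDiffAt.sum fun i _ => (hp _).mul contDiffAt_const

theorem fderiv_monic_mul {c : ℕ → E → 𝕜} {δ f : E → 𝕜} {t : 𝕜}
    (hc : ∀ j, DifferentiableAt 𝕜 (c j) x₀) (hδ : DifferentiableAt 𝕜 δ x₀)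
    (hf : f =ᶠ[𝓝 x₀] fun x => (t ^ d + ∑ j ∈ Finset.range d, t ^ j * c j x) * δ x) :
    fderiv 𝕜 f x₀ = (t ^ d + ∑ j ∈ Finset.range d, t ^ j * c j x₀) • fderiv 𝕜 δ x₀ +
      δ x₀ • ∑ j ∈ Finset.range d, t ^ j • fderiv 𝕜 (c j) x₀ := by
  have h1 : HasFDerivAt (fun x => ∑ j ∈ Finset.range d, t ^ j * c j x)
      (∑ j ∈ Finset.range d, t ^ j • fderiv 𝕜 (c j) x₀) x₀ :=
    HasFDerivAt.fun_sum fun j _ => (hc j).hasFDerivAt.const_mul (t ^ j)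
  rw [hf.fderiv_eq]
  exact ((h1.const_add (t ^ d)).mul hδ.hasFDerivAt).fderiv

/-- The same η and e serve every member of the pencil, and the final sum is linear in the bivector.
It therefore depends on t in an affine way, which is what the comparison of coefficients exploits.
-/
theorem apply_fderiv_det_gram_pencil [FiniteDimensional 𝕜 E]
    (hP : DifferentiableAt 𝕜 P x₀) (hP₁ : DifferentiableAt 𝕜 P₁ x₀)
    (alt : ∀ x α β, P x α β = -P x β α) (alt₁ : ∀ x α β, P₁ x α β = -P₁ x β α)
    {t : 𝕜} (jac : JacobiAt (fun x => t • P₁ x - P x) x₀)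
    {η : Fin d → E → (E →L[𝕜] 𝕜)} (hη : ∀ i, DifferentiableAt 𝕜 (η i) x₀) {e : Fin d → E}
    (he : ∀ i β, P x₀ (η i x₀) β = ∑ k, P x₀ (η i x₀) (η k x₀) * β (e k))
    (he₁ : ∀ i β, P₁ x₀ (η i x₀) β = ∑ k, P₁ x₀ (η i x₀) (η k x₀) * β (e k))
    (γ : E →L[𝕜] 𝕜) :
    t * P₁ x₀ γ
        (fderiv 𝕜 (fun x => (Matrix.of fun i j => (t • P₁ x - P x) (η i x) (η j x)).det) x₀) -
      P x₀ γ
        (fderiv 𝕜 (fun x => (Matrix.of fun i j => (t • P₁ x - P x) (η i x) (η j x)).det) x₀) =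
      -2 * (Matrix.of fun i j => (t • P₁ x₀ - P x₀) (η i x₀) (η j x₀)).det *
        (t * ∑ j, (fderiv 𝕜 P₁ x₀ (e j) (η j x₀) γ -
            P₁ x₀ γ (fderiv 𝕜 (fun x => η j x (e j)) x₀)) -
          ∑ j, (fderiv 𝕜 P x₀ (e j) (η j x₀) γ -
            P x₀ γ (fderiv 𝕜 (fun x => η j x (e j)) x₀))) := by
  have h1 := apply_fderiv_det_gram (A := fun x => t • P₁ x - P x) (x₀ := x₀)
    ((hP₁.const_smul t).sub hP)
    (fun x α β => by
      simp only [sub_apply, smul_apply, smul_eq_mul]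
      rw [alt, alt₁]
      ring)
    jac hη (e := e)
    (fun i β => by
      simp only [sub_apply, smul_apply, smul_eq_mul,
        sub_mul, Finset.sum_sub_distrib, mul_assoc, ← Finset.mul_sum]
      rw [he, he₁]) γ
  have h2 : fderiv 𝕜 (fun x => t • P₁ x - P x) x₀ = t • fderiv 𝕜 P₁ x₀ - fderiv 𝕜 P x₀ :=
    ((hP₁.hasFDerivAt.const_smul t).sub hP.hasFDerivAt).fderiv
  have h3 : ∑ j, (fderiv 𝕜 (fun x => t • P₁ x - P x) x₀ (e j) (η j x₀) γ -
      (t • P₁ x₀ - P x₀) γ (fderiv 𝕜 (fun x => η j x (e j)) x₀)) =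
      t * ∑ j, (fderiv 𝕜 P₁ x₀ (e j) (η j x₀) γ -
            P₁ x₀ γ (fderiv 𝕜 (fun x => η j x (e j)) x₀)) -
          ∑ j, (fderiv 𝕜 P x₀ (e j) (η j x₀) γ -
            P x₀ γ (fderiv 𝕜 (fun x => η j x (e j)) x₀)) := by
    rw [h2, Finset.mul_sum, ← Finset.sum_sub_distrib]
    refine Finset.sum_congr rfl fun j _ => ?_
    simp only [sub_apply, smul_apply, smul_eq_mul]
    ring
  beta_reduce at h1
  rw [h3] at h1
  rw [← h1]
  rfl

/-- The local form of the theorem: the characteristic polynomial depends smoothly on the point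
and the differentials of its coefficients satisfy a recursion. -/
theorem contDiffAt_coeff_and_recursion [FiniteDimensional 𝕜 E] {p : E → Polynomial 𝕜}
    (hP : ContDiffAt 𝕜 ∞ P x₀) (hP₁ : ContDiffAt 𝕜 ∞ P₁ x₀)
    (alt : ∀ x α β, P x α β = -P x β α) (alt₁ : ∀ x α β, P₁ x α β = -P₁ x β α)
    (jac : JacobiAt P x₀) (jac₁ : JacobiAt P₁ x₀) (jac₂ : JacobiAt (fun x => P x + P₁ x) x₀)
    (hF : ∀ᶠ x in 𝓝 x₀, (p x).Monic ∧ (p x).natDegree = d ∧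
      ∃ F : BlockForm (P x).toBilinForm (P₁ x).toBilinForm d, F.r = r ∧
        ∀ t, (p x).eval t * F.G₁.det = (t • F.G₁ - F.G).det) :
    (p x₀).eval 0 ≠ 0 ∧ (∀ j, ContDiffAt 𝕜 ∞ (fun x => (p x).coeff j) x₀) ∧
    ∀ γ, ∃ a b : 𝕜, ∀ t : 𝕜,
      t * P₁ x₀ γ (∑ j ∈ Finset.range d, t ^ j • fderiv 𝕜 (fun x => (p x).coeff j) x₀) -
        P x₀ γ (∑ j ∈ Finset.range d, t ^ j • fderiv 𝕜 (fun x => (p x).coeff j) x₀) =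
      (p x₀).eval t * (a + t * b) := by
  have hsmooth : (∞ : WithTop ℕ∞) ≠ 0 := by simp
  obtain ⟨-, -, F₀, hr, hF₀⟩ := hF.self_of_nhds
  obtain ⟨η, hη, hη₀, hηF⟩ := exists_frame hP hP₁
    (hF.mono fun x hx => ⟨hx.2.2.choose, hx.2.2.choose_spec.1⟩) F₀ hr
  have hdη : ∀ i, DifferentiableAt 𝕜 (η i) x₀ := fun i => (hη i).differentiableAt hsmooth
  have hdP := hP.differentiableAt hsmooth
  have hdP₁ := hP₁.differentiableAt hsmooth
  set δ : E → 𝕜 := fun x => (Matrix.of fun i j => P₁ x (η i x) (η j x)).det with hδ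
  have hδs : ContDiffAt 𝕜 ∞ δ x₀ := contDiffAt_det_gram hP₁ hη
  set D : 𝕜 → E → 𝕜 := fun t x =>
    (Matrix.of fun i j => (t • P₁ x - P x) (η i x) (η j x)).det with hD
  have hAs : ∀ t : 𝕜, ContDiffAt 𝕜 ∞ (fun x => t • P₁ x - P x) x₀ := fun t =>
    (hP₁.const_smul t).sub hP
  have hDs : ∀ t, ContDiffAt 𝕜 ∞ (D t) x₀ := fun t => contDiffAt_det_gram (hAs t) hη
  have hDδ : ∀ᶠ x in 𝓝 x₀, ∀ t, (p x).eval t * δ x = D t x := by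
    filter_upwards [hF, hηF] with x ⟨_, _, F, hFr, hFp⟩ hx t
    exact F.eval_mul_det_gram (hFp t) (hx F hFr)
  have hgram := F₀.gram_eq (v := fun i => η i x₀) (fun i => by rw [hη₀])
  have hone : (Matrix.of fun i => (F₀.e (η i x₀)).2.2) = (1 : Matrix (Fin d) (Fin d) 𝕜) := by
    ext i j
    rw [Matrix.of_apply, hη₀]
    simp [Matrix.one_apply, Pi.single_apply, eq_comm]
  rw [hone, Matrix.one_mul, Matrix.one_mul, Matrix.transpose_one, Matrix.mul_one,
    Matrix.mul_one] at hgram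
  have hδ0 : δ x₀ ≠ 0 := by
    have : δ x₀ = F₀.G₁.det := congrArg Matrix.det hgram.2
    rw [this]
    exact F₀.det_ne_zero₁
  have heval : ∀ t, ContDiffAt 𝕜 ∞ (fun x => (p x).eval t) x₀ := by
    intro t
    refine ((hDs t).div hδs hδ0).congr_of_eventuallyEq ?_
    filter_upwards [hDδ, hδs.continuousAt.eventually_ne hδ0] with x hx hx0
    rw [Pi.div_apply, ← hx t, mul_div_cancel_right₀ _ hx0]
  have hcoeff := contDiffAt_coeff (hF.mono fun x hx => hx.2.1) heval
  refine ⟨?_, hcoeff, fun γ => ?_⟩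
  · intro h0
    have h1 := hF₀ 0
    rw [h0, zero_mul, zero_smul, zero_sub, Matrix.det_neg] at h1
    have h2 := F₀.det_ne_zero
    rcases mul_eq_zero.1 h1.symm with h3 | h3
    · exact absurd h3 (pow_ne_zero _ (neg_ne_zero.2 one_ne_zero))
    · exact h2 h3
  -- the vectors dual to the frame
  have hvec : ∀ k : Fin d, ∃ v : E, ∀ β : E →L[𝕜] 𝕜, (F₀.e β).2.2 k = β v := fun k =>
    exists_forall_apply_eq (LinearMap.proj k ∘ₗ LinearMap.snd 𝕜 _ _ ∘ₗ LinearMap.snd 𝕜 _ _ ∘ₗ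
      F₀.e.toLinearMap)
  choose e he using hvec
  have hsharp : ∀ i β, P x₀ (η i x₀) β = ∑ k, P x₀ (η i x₀) (η k x₀) * β (e k) := by
    intro i β
    refine (F₀.apply_eq (η i x₀) β).trans ?_
    rw [hη₀]
    simp only [map_zero, zero_dotProduct, dotProduct_zero, sub_zero, zero_add]
    simp only [dotProduct, Matrix.single_one_vecMul, he]
    refine Finset.sum_congr rfl fun k _ => ?_
    rw [← hgram.1]
    rfl
  have hsharp₁ : ∀ i β, P₁ x₀ (η i x₀) β = ∑ k, P₁ x₀ (η i x₀) (η k x₀) * β (e k) := by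
    intro i β
    refine (F₀.apply_eq₁ (η i x₀) β).trans ?_
    rw [hη₀]
    simp only [map_zero, zero_dotProduct, dotProduct_zero, sub_zero, zero_add]
    simp only [dotProduct, Matrix.single_one_vecMul, he]
    refine Finset.sum_congr rfl fun k _ => ?_
    rw [← hgram.2]
    rfl
  set q : 𝕜 := ∑ j, (fderiv 𝕜 P x₀ (e j) (η j x₀) γ -
    P x₀ γ (fderiv 𝕜 (fun x => η j x (e j)) x₀)) with hq
  set q₁ : 𝕜 := ∑ j, (fderiv 𝕜 P₁ x₀ (e j) (η j x₀) γ -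
    P₁ x₀ γ (fderiv 𝕜 (fun x => η j x (e j)) x₀)) with hq₁
  have hGram : ∀ t : 𝕜, t * P₁ x₀ γ (fderiv 𝕜 (D t) x₀) - P x₀ γ (fderiv 𝕜 (D t) x₀) =
      -2 * D t x₀ * (t * q₁ - q) := by
    intro t
    exact apply_fderiv_det_gram_pencil hdP hdP₁ alt alt₁
      (JacobiAt.pencil hdP hdP₁ jac jac₁ jac₂ t) hdη hsharp hsharp₁ γ
  have hder : ∀ t : 𝕜, fderiv 𝕜 (D t) x₀ =
      (p x₀).eval t • fderiv 𝕜 δ x₀ +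
        δ x₀ • ∑ j ∈ Finset.range d, t ^ j • fderiv 𝕜 (fun x => (p x).coeff j) x₀ := by
    intro t
    have h1 : D t =ᶠ[𝓝 x₀]
        fun x => (t ^ d + ∑ j ∈ Finset.range d, t ^ j * (p x).coeff j) * δ x := by
      filter_upwards [hDδ, hF] with x hx hFx
      rw [← hx t, Polynomial.eval_eq_sum_range, hFx.2.1, Finset.sum_range_succ]
      have h2 := hFx.1.coeff_natDegree
      rw [hFx.2.1] at h2
      rw [h2]
      simp only [mul_comm (t ^ _)]
      ring
    rw [fderiv_monic_mul (fun j => (hcoeff j).differentiableAt hsmooth)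
      (hδs.differentiableAt hsmooth) h1]
    have h3 := h1.self_of_nhds
    rw [← hDδ.self_of_nhds t] at h3
    rw [mul_right_cancel₀ hδ0 h3]
  -- Obtained by inserting dD_t = p(t) dδ + δ ∑ tʲ dh_j into `hGram`, with D_t = p(t) δ, and
  -- dividing by δ.
  refine ⟨2 * q + P x₀ γ (fderiv 𝕜 δ x₀) / δ x₀, -2 * q₁ - P₁ x₀ γ (fderiv 𝕜 δ x₀) / δ x₀,
    fun t => ?_⟩
  have h1 := hGram t
  rw [hder, ← hDδ.self_of_nhds t] at h1
  simp only [map_add, map_smul, smul_eq_mul] at h1 ⊢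
  field_simp
  simp only [map_sum, map_smul, smul_eq_mul] at h1 ⊢
  linear_combination h1

end Local

/-! ### Passage to charts -/

namespace Bihamiltonian

set_option maxSynthPendingDepth 3

variable {𝕜 : Type*} [RCLike 𝕜] {E : Type*} [NormedAddCommGroup E] [NormedSpace 𝕜 E]
  {M : Type*} [TopologicalSpace M] [ChartedSpace E M]

theorem neg_swap_of_isAlt {V : Type*} [AddCommGroup V] [Module 𝕜 V]
    {μ : LinearMap.BilinForm 𝕜 V} (h : μ.IsAlt) (α β : V) : μ α β = -μ β α :=
  (LinearMap.IsAlt.neg h β α).symm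

/-- The pull-back of covectors by the chart at `p₀`. -/
def chartPullback (p₀ q : M) : (E →L[𝕜] 𝕜) →ₗ[𝕜] Dual 𝕜 (TangentSpace 𝓘(𝕜, E) q) where
  toFun α := (α.comp (mfderiv 𝓘(𝕜, E) 𝓘(𝕜, E) (extChartAt 𝓘(𝕜, E) p₀) q :
    TangentSpace 𝓘(𝕜, E) q →L[𝕜] E)).toLinearMap
  map_add' _ _ := rfl
  map_smul' _ _ := rfl

variable [FiniteDimensional 𝕜 E]

/-- The components of a field of bivectors in the chart at `p₀`. -/
def localForm (Λ : BivectorField 𝕜 E M) (p₀ : M) (x : E) :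
    (E →L[𝕜] 𝕜) →L[𝕜] (E →L[𝕜] 𝕜) →L[𝕜] 𝕜 :=
  LinearMap.toContinuousBilinearMap
    ((Λ ((extChartAt 𝓘(𝕜, E) p₀).symm x)).compl₁₂ (chartPullback p₀ _) (chartPullback p₀ _))

theorem localForm_apply (Λ : BivectorField 𝕜 E M) (p₀ : M) (x : E) (α β : E →L[𝕜] 𝕜) :
    localForm Λ p₀ x α β = Λ ((extChartAt 𝓘(𝕜, E) p₀).symm x)
      (chartPullback p₀ _ α) (chartPullback p₀ _ β) := rfl

theorem localForm_add (Λ Λ₁ : BivectorField 𝕜 E M) (p₀ : M) :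
    localForm (fun p => Λ p + Λ₁ p) p₀ = fun x => localForm Λ p₀ x + localForm Λ₁ p₀ x := by
  ext x α β
  rfl

variable [IsManifold 𝓘(𝕜, E) ∞ M]

/-- The pull-back of covectors by the chart at `p₀` as an isomorphism. -/
theorem exists_chartPullback_equiv {p₀ q : M} (hq : q ∈ (extChartAt 𝓘(𝕜, E) p₀).source) :
    ∃ f : (E →L[𝕜] 𝕜) ≃ₗ[𝕜] Dual 𝕜 (TangentSpace 𝓘(𝕜, E) q),
      ∀ α, f α = chartPullback p₀ q α := by
  have : IsManifold 𝓘(𝕜, E) 1 M := IsManifold.of_le (n := ∞) (by simp)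
  obtain ⟨T, hT⟩ := isInvertible_mfderiv_extChartAt (I := 𝓘(𝕜, E)) hq
  let T' : TangentSpace 𝓘(𝕜, E) q ≃ₗ[𝕜] E := T.toLinearEquiv
  refine ⟨(LinearMap.toContinuousLinearMap : (E →ₗ[𝕜] 𝕜) ≃ₗ[𝕜] (E →L[𝕜] 𝕜)).symm.trans
    T'.dualMap, fun α => ?_⟩
  ext v
  change α (T v) = α (mfderiv 𝓘(𝕜, E) 𝓘(𝕜, E) (extChartAt 𝓘(𝕜, E) p₀) q v)
  rw [← hT]
  rfl

omit [FiniteDimensional 𝕜 E] in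
theorem differential_eq {p₀ q : M} (hq : q ∈ (extChartAt 𝓘(𝕜, E) p₀).source) {f : M → 𝕜}
    {g : E → 𝕜} (hg : DifferentiableAt 𝕜 g (extChartAt 𝓘(𝕜, E) p₀ q))
    (hf : f =ᶠ[𝓝 q] g ∘ extChartAt 𝓘(𝕜, E) p₀) :
    differential E f q =
      chartPullback p₀ q (fderiv 𝕜 g (extChartAt 𝓘(𝕜, E) p₀ q)) := by
  have : IsManifold 𝓘(𝕜, E) 1 M := IsManifold.of_le (n := ∞) (by simp)
  have hφ : MDifferentiableAt 𝓘(𝕜, E) 𝓘(𝕜, E) (extChartAt 𝓘(𝕜, E) p₀) q :=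
    mdifferentiableAt_extChartAt (by rwa [extChartAt_source] at hq)
  have h : mfderiv 𝓘(𝕜, E) 𝓘(𝕜, 𝕜) f q =
      (mfderiv 𝓘(𝕜, E) 𝓘(𝕜, 𝕜) g (extChartAt 𝓘(𝕜, E) p₀ q)).comp
        (mfderiv 𝓘(𝕜, E) 𝓘(𝕜, E) (extChartAt 𝓘(𝕜, E) p₀) q) := by
    rw [hf.mfderiv_eq]
    exact mfderiv_comp q hg.mdifferentiableAt hφ
  rw [mfderiv_eq_fderiv] at h
  unfold differential
  rw [h]
  rfl

theorem bracket_eq_localForm {Λ : BivectorField 𝕜 E M} {p₀ q : M}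
    (hq : q ∈ (extChartAt 𝓘(𝕜, E) p₀).source) {f f' : M → 𝕜} {g g' : E → 𝕜}
    (hg : DifferentiableAt 𝕜 g (extChartAt 𝓘(𝕜, E) p₀ q))
    (hf : f =ᶠ[𝓝 q] g ∘ extChartAt 𝓘(𝕜, E) p₀)
    (hg' : DifferentiableAt 𝕜 g' (extChartAt 𝓘(𝕜, E) p₀ q))
    (hf' : f' =ᶠ[𝓝 q] g' ∘ extChartAt 𝓘(𝕜, E) p₀) :
    bracket Λ f f' q = localForm Λ p₀ (extChartAt 𝓘(𝕜, E) p₀ q)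
      (fderiv 𝕜 g (extChartAt 𝓘(𝕜, E) p₀ q)) (fderiv 𝕜 g' (extChartAt 𝓘(𝕜, E) p₀ q)) := by
  rw [bracket, differential_eq hq hg hf, differential_eq hq hg' hf', localForm_apply,
    (extChartAt 𝓘(𝕜, E) p₀).left_inv hq]

theorem bracket_comp_chart {Λ : BivectorField 𝕜 E M} {p₀ q : M}
    (hq : q ∈ (extChartAt 𝓘(𝕜, E) p₀).source) (α β : E →L[𝕜] 𝕜) :
    bracket Λ (α ∘ extChartAt 𝓘(𝕜, E) p₀) (β ∘ extChartAt 𝓘(𝕜, E) p₀) q =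
      localForm Λ p₀ (extChartAt 𝓘(𝕜, E) p₀ q) α β := by
  rw [bracket_eq_localForm hq α.differentiableAt Filter.EventuallyEq.rfl β.differentiableAt
    Filter.EventuallyEq.rfl, α.fderiv, β.fderiv]

omit [FiniteDimensional 𝕜 E] in
theorem contMDiffOn_comp_chart (p₀ : M) (α : E →L[𝕜] 𝕜) :
    ContMDiffOn 𝓘(𝕜, E) 𝓘(𝕜, 𝕜) ∞ (α ∘ extChartAt 𝓘(𝕜, E) p₀)
      (extChartAt 𝓘(𝕜, E) p₀).source := by
  rw [extChartAt_source]
  exact α.contMDiff.comp_contMDiffOn contMDiffOn_extChartAt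

/-- The components are brackets of linear functions of the chart, and these functions are smooth on
its domain. -/
theorem contDiffAt_localForm {Λ : BivectorField 𝕜 E M} (hΛ : IsPoisson Λ) {p₀ : M} {x : E}
    (hx : x ∈ (extChartAt 𝓘(𝕜, E) p₀).target) : ContDiffAt 𝕜 ∞ (localForm Λ p₀) x := by
  suffices h : ContDiffOn 𝕜 ∞ (localForm Λ p₀) (extChartAt 𝓘(𝕜, E) p₀).target from
    h.contDiffAt ((isOpen_extChartAt_target p₀).mem_nhds hx)
  rw [contDiffOn_clm_apply]
  intro α
  rw [contDiffOn_clm_apply]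
  intro β
  have h1 := hΛ.smooth _ (isOpen_extChartAt_source p₀) _ _ (contMDiffOn_comp_chart p₀ α)
    (contMDiffOn_comp_chart p₀ β)
  have h2 := h1.comp (contMDiffOn_extChartAt_symm p₀)
    (fun y hy => (extChartAt 𝓘(𝕜, E) p₀).map_target hy)
  rw [contMDiffOn_iff_contDiffOn] at h2
  refine h2.congr fun y hy => ?_
  rw [Function.comp_apply, bracket_comp_chart ((extChartAt 𝓘(𝕜, E) p₀).map_target hy),
    (extChartAt 𝓘(𝕜, E) p₀).right_inv hy]

/-- This is the Jacobi identity for linear functions of the chart: their differentials are constant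
there, so in a nested bracket only the bivector is differentiated. -/
theorem jacobiAt_localForm {Λ : BivectorField 𝕜 E M} (hΛ : IsPoisson Λ) {p₀ q : M}
    (hq : q ∈ (extChartAt 𝓘(𝕜, E) p₀).source) :
    JacobiAt (localForm Λ p₀) (extChartAt 𝓘(𝕜, E) p₀ q) := by
  have hd : ∀ α β : E →L[𝕜] 𝕜, DifferentiableAt 𝕜 (fun x => localForm Λ p₀ x α β)
      (extChartAt 𝓘(𝕜, E) p₀ q) := fun α β =>
    (((contDiffAt_localForm hΛ ((extChartAt 𝓘(𝕜, E) p₀).map_source hq)).differentiableAt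
      (by simp)).clm_apply (differentiableAt_const _)).clm_apply (differentiableAt_const _)
  have hb : ∀ α β : E →L[𝕜] 𝕜,
      bracket Λ (α ∘ extChartAt 𝓘(𝕜, E) p₀) (β ∘ extChartAt 𝓘(𝕜, E) p₀) =ᶠ[𝓝 q]
        (fun x => localForm Λ p₀ x α β) ∘ extChartAt 𝓘(𝕜, E) p₀ := by
    intro α β
    filter_upwards [(isOpen_extChartAt_source p₀).mem_nhds hq] with q' hq'
    exact bracket_comp_chart hq' α β
  have hbb : ∀ α β γ : E →L[𝕜] 𝕜, bracket Λ (α ∘ extChartAt 𝓘(𝕜, E) p₀)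
      (bracket Λ (β ∘ extChartAt 𝓘(𝕜, E) p₀) (γ ∘ extChartAt 𝓘(𝕜, E) p₀)) q =
      localForm Λ p₀ (extChartAt 𝓘(𝕜, E) p₀ q) α
        (fderiv 𝕜 (fun x => localForm Λ p₀ x β γ) (extChartAt 𝓘(𝕜, E) p₀ q)) := by
    intro α β γ
    rw [bracket_eq_localForm hq α.differentiableAt Filter.EventuallyEq.rfl (hd β γ) (hb β γ),
      α.fderiv]
  intro α β γ
  rw [← hbb, ← hbb, ← hbb]
  exact hΛ.jacobi _ (isOpen_extChartAt_source p₀) _ _ _ (contMDiffOn_comp_chart p₀ α)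
    (contMDiffOn_comp_chart p₀ β) (contMDiffOn_comp_chart p₀ γ) q hq

/-- Near every point of `M'` the coefficients of the characteristic polynomial are smooth, and
their differentials satisfy the recursion. -/
theorem charCoeff_local {Λ Λ₁ : BivectorField 𝕜 E M} (hΛ : IsBihamiltonian Λ Λ₁) {M' : Set M}
    (hM' : IsOpen M') {r d : ℕ} (hd0 : d ≠ 0) (hmax : ∀ p ∈ M', IsMaximal (Λ p) (Λ₁ p))
    (hrank : ∀ p ∈ M', pairRank (Λ p) (Λ₁ p) + r = finrank 𝕜 E)
    (hdim : ∀ p ∈ M', symplecticDim (Λ p) (Λ₁ p) = d) {p : M} (hp : p ∈ M') :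
    (∀ j, ContMDiffAt 𝓘(𝕜, E) 𝓘(𝕜, 𝕜) ∞ (charCoeff Λ Λ₁ j) p) ∧
    (symplecticCharpoly (Λ p) (Λ₁ p)).eval 0 ≠ 0 ∧
    ∀ γ : Dual 𝕜 (TangentSpace 𝓘(𝕜, E) p), ∃ a b : 𝕜, ∀ t : 𝕜,
      t * Λ₁ p γ (∑ j ∈ Finset.range d, t ^ j • differential E (charCoeff Λ Λ₁ j) p) -
        Λ p γ (∑ j ∈ Finset.range d, t ^ j • differential E (charCoeff Λ Λ₁ j) p) =
      (symplecticCharpoly (Λ p) (Λ₁ p)).eval t * (a + t * b) := by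
  set φ := extChartAt 𝓘(𝕜, E) p with hφ
  have hps : p ∈ φ.source := mem_extChartAt_source p
  have hpt : φ p ∈ φ.target := φ.map_source hps
  have hφp : φ.symm (φ p) = p := φ.left_inv hps
  let P : E → Polynomial 𝕜 := fun x => symplecticCharpoly (Λ (φ.symm x)) (Λ₁ (φ.symm x))
  have hnear : ∀ᶠ x in 𝓝 (φ p), x ∈ φ.target ∧ φ.symm x ∈ M' := by
    have h1 : ∀ᶠ x in 𝓝 (φ p), φ.symm x ∈ M' :=
      (continuousAt_extChartAt_symm p).eventually_mem (hM'.mem_nhds (by rwa [← hφ, hφp]))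
    filter_upwards [(isOpen_extChartAt_target p).mem_nhds hpt, h1] with x hx hx' using ⟨hx, hx'⟩
  have hF : ∀ᶠ x in 𝓝 (φ p), (P x).Monic ∧ (P x).natDegree = d ∧
      ∃ F : BlockForm (localForm Λ p x).toBilinForm (localForm Λ₁ p x).toBilinForm d, F.r = r ∧
        ∀ t, (P x).eval t * F.G₁.det = (t • F.G₁ - F.G).det := by
    filter_upwards [hnear] with x ⟨hxt, hxM⟩
    obtain ⟨hm, hn, F, hFr, hFp⟩ := exists_blockForm_of_isMaximal hd0 (hmax _ hxM)
      (hrank _ hxM) (hdim _ hxM)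
    obtain ⟨f, hf⟩ := exists_chartPullback_equiv (φ.map_target hxt)
    exact ⟨hm, hn, F.congr f (fun α β => by rw [hf, hf]; rfl) (fun α β => by rw [hf, hf]; rfl),
      hFr, hFp⟩
  have hjac : ∀ {Λ' : BivectorField 𝕜 E M}, IsPoisson Λ' → JacobiAt (localForm Λ' p) (φ p) :=
    fun h => jacobiAt_localForm h hps
  obtain ⟨h0, hsm, hrec⟩ := contDiffAt_coeff_and_recursion (p := P)
    (contDiffAt_localForm hΛ.poisson hpt) (contDiffAt_localForm hΛ.poisson₁ hpt)
    (fun x α β => neg_swap_of_isAlt (hΛ.poisson.alt _) _ _)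
    (fun x α β => neg_swap_of_isAlt (hΛ.poisson₁.alt _) _ _)
    (hjac hΛ.poisson) (hjac hΛ.poisson₁)
    (by rw [← localForm_add]; exact hjac hΛ.compatible) hF
  have hcoeff : ∀ j, charCoeff Λ Λ₁ j =ᶠ[𝓝 p] (fun x => (P x).coeff j) ∘ φ := by
    intro j
    filter_upwards [(isOpen_extChartAt_source p).mem_nhds hps] with q hq
    change _ = (symplecticCharpoly (Λ (φ.symm (φ q))) (Λ₁ (φ.symm (φ q)))).coeff j
    rw [φ.left_inv hq]
    rfl
  have hdiff : ∀ j, differential E (charCoeff Λ Λ₁ j) p =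
      chartPullback p p (fderiv 𝕜 (fun x => (P x).coeff j) (φ p)) := fun j =>
    differential_eq hps ((hsm j).differentiableAt (by simp)) (hcoeff j)
  have hPp : P (φ p) = symplecticCharpoly (Λ p) (Λ₁ p) := by
    change symplecticCharpoly (Λ (φ.symm (φ p))) (Λ₁ (φ.symm (φ p))) = _
    rw [hφp]
  have hlf : ∀ (Λ' : BivectorField 𝕜 E M) (α β : E →L[𝕜] 𝕜), localForm Λ' p (φ p) α β =
      Λ' p (chartPullback p p α) (chartPullback p p β) := by
    intro Λ' α β
    rw [localForm_apply, hφp]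
  refine ⟨fun j => ?_, hPp ▸ h0, fun γ => ?_⟩
  · refine ContMDiffAt.congr_of_eventuallyEq ?_ (hcoeff j)
    exact (hsm j).contMDiffAt.comp p contMDiffAt_extChartAt
  · obtain ⟨f, hf⟩ := exists_chartPullback_equiv hps
    obtain ⟨a, b, hab⟩ := hrec (f.symm γ)
    refine ⟨a, b, fun t => ?_⟩
    have h1 := hab t
    rw [hlf, hlf, hPp, ← hf, f.apply_symm_apply, map_sum] at h1
    simp only [map_smul, ← hdiff] at h1
    exact h1

end Bihamiltonian

/-! ### The main theorem -/

open Bihamiltonian in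
theorem proposition7p1 {𝕜 : Type*} [RCLike 𝕜]
    {E : Type*} [NormedAddCommGroup E] [NormedSpace 𝕜 E] [FiniteDimensional 𝕜 E]
    {M : Type*} [TopologicalSpace M] [ChartedSpace E M] [IsManifold 𝓘(𝕜, E) ∞ M]
    (Λ Λ₁ : Bihamiltonian.BivectorField 𝕜 E M) (hΛ : Bihamiltonian.IsBihamiltonian Λ Λ₁)
    (M' : Set M) (hM' : IsOpen M') (r m' : ℕ)
    (hmax : ∀ p ∈ M', Bivector.IsMaximal (Λ p) (Λ₁ p))
    (hrank : ∀ p ∈ M', Bivector.pairRank (Λ p) (Λ₁ p) + r = Module.finrank 𝕜 E)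
    (hdim : ∀ p ∈ M', Bivector.symplecticDim (Λ p) (Λ₁ p) = 2 * m') :
    (∀ j < 2 * m', ContMDiffOn 𝓘(𝕜, E) 𝓘(𝕜, 𝕜) ∞ (Bihamiltonian.charCoeff Λ Λ₁ j) M') ∧
    (∀ i < 2 * m', ∀ j < 2 * m', ∀ p ∈ M',
      Bihamiltonian.bracket Λ (Bihamiltonian.charCoeff Λ Λ₁ i)
        (Bihamiltonian.charCoeff Λ Λ₁ j) p = 0 ∧
      Bihamiltonian.bracket Λ₁ (Bihamiltonian.charCoeff Λ Λ₁ i)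
        (Bihamiltonian.charCoeff Λ Λ₁ j) p = 0) ∧
    (∀ p ∈ M',
      Submodule.span 𝕜 (Set.range fun j : Fin (2 * m') =>
        Bihamiltonian.hamiltonian Λ (Bihamiltonian.charCoeff Λ Λ₁ j) p) =
      Submodule.span 𝕜 (Set.range fun j : Fin (2 * m') =>
        Bihamiltonian.hamiltonian Λ₁ (Bihamiltonian.charCoeff Λ Λ₁ j) p)) := by
  -- For m' = 0 there is nothing to prove. The case is separated because dimension 0 does not by
  -- itself guarantee a decomposition.
  rcases Nat.eq_zero_or_pos m' with rfl | hm'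
  · refine ⟨fun j hj => absurd hj (Nat.not_lt_zero j), fun i hi => absurd hi (Nat.not_lt_zero i),
      fun p _ => ?_⟩
    have : IsEmpty (Fin (2 * 0)) := Fin.isEmpty
    rw [Set.range_eq_empty, Set.range_eq_empty]
  have hd0 : 2 * m' ≠ 0 := by omega
  have hlocal := fun p (hp : p ∈ M') => charCoeff_local hΛ hM' hd0 hmax hrank hdim hp
  have hpoint : ∀ p ∈ M', _ := fun p hp => by
    obtain ⟨-, h0, hrec⟩ := hlocal p hp
    obtain ⟨hmonic, hdeg, -⟩ := Bivector.exists_blockForm_of_isMaximal hd0 (hmax p hp)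
      (hrank p hp) (hdim p hp)
    -- Truncated at degree 2m', as the recursion requires.
    let θ : ℕ → Dual 𝕜 (TangentSpace 𝓘(𝕜, E) p) := fun j =>
      if j < 2 * m' then differential E (charCoeff Λ Λ₁ j) p else 0
    have hθ : ∀ t : 𝕜, ∑ j ∈ Finset.range (2 * m'), t ^ j • θ j =
        ∑ j ∈ Finset.range (2 * m'), t ^ j • differential E (charCoeff Λ Λ₁ j) p := fun t =>
      Finset.sum_congr rfl fun j hj =>
        congrArg (t ^ j • ·) (if_pos (Finset.mem_range.1 hj))
    exact Bivector.involution_and_span_eq (θ := θ) (neg_swap_of_isAlt (hΛ.poisson.alt p))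
      (neg_swap_of_isAlt (hΛ.poisson₁.alt p)) two_ne_zero
      (fun j hj => if_neg (not_lt.2 hj)) hmonic hdeg h0
      (fun γ => by simpa only [hθ] using hrec γ)
  refine ⟨fun j _ p hp => ((hlocal p hp).1 j).contMDiffWithinAt, fun i hi j hj p hp => ?_,
    fun p hp => ?_⟩
  · have h := (hpoint p hp).1 i j
    simp only [if_pos hi, if_pos hj] at h
    exact h
  · have h := (hpoint p hp).2
    simp only [Fin.is_lt, if_true] at h
    -- Biduality carries the functionals Λ(dh_j, ·) on covectors to the hamiltonian vectors.
    have h2 := congrArg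
      (Submodule.map (evalEquiv 𝕜 (TangentSpace 𝓘(𝕜, E) p)).symm.toLinearMap) h
    rw [Submodule.map_span, Submodule.map_span, ← Set.range_comp, ← Set.range_comp] at h2
    exact h2
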